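/- Let $d\ge 1$ be an integer, let $1\le q<\infty$, and let $\mathbb K$ be $\mathbb R$ or $\mathbb C$ (the field of scalars). Write $|x|_\infty=\max(|x_1|,\dots,|x_d|)$ for $x\in\mathbb Z^d$. For an infinite matrix $A=(a(i,j))_{i,j\in\mathbb Z^d}$ with entries in $\mathbb K$ put $$\|A\|_{\mathcal B}:=\sum_{k\in\mathbb Z^d}\ \sup_{|i-j|_\infty\ge |k|_\infty}|a(i,j)|\in[0,\infty],\qquad \mathcal B=\mathcal B(\mathbb Z^d,\mathbb Z^d):=\{A:\ \|A\|_{\mathcal B}<\infty\}.$$ A positive sequence $w=(w(i))_{i\in\mathbb Z^d}$ is a *discrete $A_q$-weight* if there is a constant $C>0$ such that for all $a\in\mathbb Z^d$ and all integers $N\ge 1$, with $Q=a+[0,N-1]^d$ (a cube in $\mathbb Z^d$), $$\Big(N^{-d}\sum_{i\in Q}w(i)\Big)\Big(N^{-d}\sum_{i\in Q}w(i)^{-1/(q-1)}\Big)^{q-1}\le C\quad\text{if } 1<q<\infty,$$ $$N^{-d}\sum_{i\in Q}w(i)\le C\inf_{i\in Q}w(i)\quad\text{if } q=1.$$ Let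 $\ell^q_w$ be the space of all $c:\mathbb Z^d\to\mathbb K$ with $\|c\|_{q,w}:=\big(\sum_{i}|c(i)|^q w(i)\big)^{1/q}<\infty$, and let $\mathcal B(\ell^q_w)$ be the algebra of all bounded linear operators on $\ell^q_w$. A matrix $A$ defines an operator $T\in\mathcal B(\ell^q_w)$ if $(Tc)(i)=\sum_{j}a(i,j)c(j)$, with convergent sums, for all $c\in\ell^q_w$ and $i\in\mathbb Z^d$. **Theorem.** Let $w$ be a discrete $A_q$-weight. Then $\mathcal B$ is an inverse-closed subalgebra of $\mathcal B(\ell^q_w)$. That is: 1. every $A\in\mathcal B$ defines exactly one operator in $\mathcal B(\ell^q_w)$, and different matrices in $\mathcal B$ define different operators; 2. if $A,B\in\mathcal B$, then the sums $\sum_j a(i,j)b(j,k)$ converge, the matrix product $AB$ belongs to $\mathcal B$, and the operator it defines is the composition of the operators defined by $A$ and $B$; 3. the operators defined by the matrices in $\mathcal B$ form a (unital) subalgebra of $\mathcal B(\ell^q_w)$; 4. if the operator defined by some $A\in\mathcal B$ has an inverse in $\mathcal B(\ell^q_w)$, then this inverse is defined by a matrix in $\mathcal B$. -/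

import Mathlib

open scoped ENNReal

/-- A positive sequence `(w(i))` indexed by `ι`. -/
abbrev PosSeq (ι : Type*) : Type _ := ι → {x : ℝ // 0 < x}

section WeightedLq

/-- The vector space of all scalar sequences `c` with `∑ |c(i)|^q w(i) < ∞`. -/
def weightedLqSubmodule (𝕜 : Type*) [RCLike 𝕜] {ι : Type*} (q : ℝ) [Fact (1 ≤ q)]
    (w : PosSeq ι) : Submodule 𝕜 (ι → 𝕜) where
  carrier := {c | Summable fun i => ‖c i‖ ^ q * (w i : ℝ)}
  zero_mem' := by
    have hq : (1 : ℝ) ≤ q := Fact.out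
    have : (fun i => ‖(0 : ι → 𝕜) i‖ ^ q * (w i : ℝ)) = fun _ => 0 := by
      funext i
      simp [Real.zero_rpow (by linarith : q ≠ 0)]
    change Summable _
    rw [this]
    exact summable_zero
  add_mem' := by
    intro a b ha hb
    have hq : (1 : ℝ) ≤ q := Fact.out
    change Summable _ at ha hb ⊢
    refine Summable.of_nonneg_of_le
      (fun i => mul_nonneg (Real.rpow_nonneg (norm_nonneg _) _) (w i).2.le) (fun i => ?_)
      ((ha.add hb).mul_left (2 ^ (q - 1)))
    have h1 : ‖(a + b) i‖ ^ q ≤ (‖a i‖ + ‖b i‖) ^ q :=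
      Real.rpow_le_rpow (norm_nonneg _) (norm_add_le _ _) (by linarith)
    have h2 : (‖a i‖ + ‖b i‖) ^ q ≤ 2 ^ (q - 1) * (‖a i‖ ^ q + ‖b i‖ ^ q) :=
      mod_cast NNReal.rpow_add_le_mul_rpow_add_rpow ‖a i‖₊ ‖b i‖₊ hq
    calc ‖(a + b) i‖ ^ q * (w i : ℝ)
        ≤ 2 ^ (q - 1) * (‖a i‖ ^ q + ‖b i‖ ^ q) * (w i : ℝ) :=
          mul_le_mul_of_nonneg_right (h1.trans h2) (w i).2.le
      _ = _ := by ring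
  smul_mem' := by
    intro k c hc
    change Summable _ at hc ⊢
    have : (fun i => ‖(k • c) i‖ ^ q * (w i : ℝ))
        = fun i => ‖k‖ ^ q * (‖c i‖ ^ q * (w i : ℝ)) := by
      funext i
      rw [Pi.smul_apply, norm_smul, Real.mul_rpow (norm_nonneg _) (norm_nonneg _), mul_assoc]
    rw [this]
    exact hc.mul_left _

/-- The weighted sequence space `ℓ^q_w`. It is a type synonym, so that it carries the topology
of its own norm and not the topology of pointwise convergence. -/
def WeightedLq (𝕜 : Type*) [RCLike 𝕜] {ι : Type*} (q : ℝ) [Fact (1 ≤ q)] (w : PosSeq ι) :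
    Type _ :=
  weightedLqSubmodule 𝕜 q w

namespace WeightedLq

variable {𝕜 : Type*} [RCLike 𝕜] {ι : Type*} {q : ℝ} [Fact (1 ≤ q)] {w : PosSeq ι}

instance : AddCommGroup (WeightedLq 𝕜 q w) :=
  inferInstanceAs (AddCommGroup (weightedLqSubmodule 𝕜 q w))

instance : Module 𝕜 (WeightedLq 𝕜 q w) :=
  inferInstanceAs (Module 𝕜 (weightedLqSubmodule 𝕜 q w))

instance : CoeFun (WeightedLq 𝕜 q w) (fun _ => ι → 𝕜) := ⟨fun c => c.1⟩

theorem ext {c c' : WeightedLq 𝕜 q w} (h : ∀ i, c i = c' i) : c = c' :=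
  Subtype.ext (funext h)

theorem add_apply (c c' : WeightedLq 𝕜 q w) (i : ι) : (c + c') i = c i + c' i := rfl

theorem zero_apply (i : ι) : (0 : WeightedLq 𝕜 q w) i = 0 := rfl

theorem smul_apply (k : 𝕜) (c : WeightedLq 𝕜 q w) (i : ι) : (k • c) i = k * c i := rfl

theorem summable (c : WeightedLq 𝕜 q w) : Summable fun i => ‖c i‖ ^ q * (w i : ℝ) := c.2

/-- `‖c‖_{q,w} = (∑ |c(i)|^q w(i))^{1/q}`. -/
noncomputable instance : Norm (WeightedLq 𝕜 q w) :=
  ⟨fun c => (∑' i, ‖c i‖ ^ q * (w i : ℝ)) ^ (1 / q)⟩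

theorem norm_def (c : WeightedLq 𝕜 q w) :
    ‖c‖ = (∑' i, ‖c i‖ ^ q * (w i : ℝ)) ^ (1 / q) := rfl

theorem core : NormedSpace.Core 𝕜 (WeightedLq 𝕜 q w) := by
  have hq : (1 : ℝ) ≤ q := Fact.out
  have hq0 : q ≠ 0 := by linarith
  have hterm : ∀ (c : WeightedLq 𝕜 q w) i, 0 ≤ ‖c i‖ ^ q * (w i : ℝ) := fun c i =>
    mul_nonneg (Real.rpow_nonneg (norm_nonneg _) _) (w i).2.le
  have hpow : ∀ (x : ℝ), 0 ≤ x → ∀ i, (x * (w i : ℝ) ^ (1 / q)) ^ q = x ^ q * (w i : ℝ) := by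
    intro x hx i
    rw [Real.mul_rpow hx (Real.rpow_nonneg (w i).2.le _), ← Real.rpow_mul (w i).2.le,
      one_div_mul_cancel hq0, Real.rpow_one]
  refine { norm_nonneg := ?_, norm_smul := ?_, norm_triangle := ?_, norm_eq_zero_iff := ?_ }
  · intro c
    exact Real.rpow_nonneg (tsum_nonneg (hterm c)) _
  · intro k c
    have : (fun i => ‖(k • c) i‖ ^ q * (w i : ℝ))
        = fun i => ‖k‖ ^ q * (‖c i‖ ^ q * (w i : ℝ)) := by
      funext i
      rw [smul_apply, norm_mul, Real.mul_rpow (norm_nonneg _) (norm_nonneg _), mul_assoc]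
    rw [norm_def, norm_def, this, tsum_mul_left,
      Real.mul_rpow (Real.rpow_nonneg (norm_nonneg _) _) (tsum_nonneg (hterm c)),
      ← Real.rpow_mul (norm_nonneg _), mul_one_div_cancel hq0, Real.rpow_one]
  · intro c c'
    have hw : ∀ i, 0 ≤ (w i : ℝ) ^ (1 / q) := fun i => Real.rpow_nonneg (w i).2.le _
    have key := Real.Lp_add_le_tsum_of_nonneg (p := q)
      (f := fun i => ‖c i‖ * (w i : ℝ) ^ (1 / q)) (g := fun i => ‖c' i‖ * (w i : ℝ) ^ (1 / q)) hq
      (fun i => mul_nonneg (norm_nonneg _) (hw i)) (fun i => mul_nonneg (norm_nonneg _) (hw i))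
      (by simpa only [hpow _ (norm_nonneg _)] using c.summable)
      (by simpa only [hpow _ (norm_nonneg _)] using c'.summable)
    simp only [hpow _ (norm_nonneg _), ← add_mul,
      hpow _ (add_nonneg (norm_nonneg _) (norm_nonneg _))] at key
    rw [norm_def, norm_def, norm_def]
    refine le_trans (Real.rpow_le_rpow (tsum_nonneg (hterm _)) ?_ (by positivity)) key.2
    refine Summable.tsum_le_tsum (fun i => ?_) (c + c').summable key.1
    exact mul_le_mul_of_nonneg_right
      (Real.rpow_le_rpow (norm_nonneg _) (norm_add_le _ _) (by linarith)) (w i).2.le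
  · intro c
    constructor
    · intro h
      rw [norm_def, Real.rpow_eq_zero (tsum_nonneg (hterm c)) (one_div_ne_zero hq0)] at h
      have h0 := (hasSum_zero_iff_of_nonneg (hterm c)).1 (h ▸ c.summable.hasSum)
      refine ext fun i => ?_
      have hi := congrFun h0 i
      simp only [Pi.zero_apply, mul_eq_zero, (w i).2.ne', or_false,
        Real.rpow_eq_zero (norm_nonneg _) hq0, norm_eq_zero] at hi
      simpa [zero_apply] using hi
    · rintro rfl
      rw [norm_def]
      simp [zero_apply, Real.zero_rpow hq0, Real.zero_rpow (inv_ne_zero hq0)]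

noncomputable instance : NormedAddCommGroup (WeightedLq 𝕜 q w) := NormedAddCommGroup.ofCore core

noncomputable instance : NormedSpace 𝕜 (WeightedLq 𝕜 q w) := NormedSpace.ofCore core

end WeightedLq

end WeightedLq

section Muckenhoupt

/-- The discrete cube `a + [0, N-1]^d` in `ℤ^d`. -/
noncomputable def latticeCube {d : ℕ} (a : Fin d → ℤ) (N : ℕ) : Finset (Fin d → ℤ) :=
  Fintype.piFinset fun m => Finset.Ico (a m) (a m + (N : ℤ))

/-- Discrete Muckenhoupt `A_q`-weights on `ℤ^d`, for `1 ≤ q < ∞`. -/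
def IsDiscreteAqWeight {d : ℕ} (q : ℝ) (w : PosSeq (Fin d → ℤ)) : Prop :=
  (q = 1 ∧ ∃ C : ℝ, 0 < C ∧ ∀ (a : Fin d → ℤ) (N : ℕ), 1 ≤ N → ∀ i ∈ latticeCube a N,
      ((N : ℝ) ^ d)⁻¹ * ∑ j ∈ latticeCube a N, (w j : ℝ) ≤ C * (w i : ℝ)) ∨
  (1 < q ∧ ∃ C : ℝ, 0 < C ∧ ∀ (a : Fin d → ℤ) (N : ℕ), 1 ≤ N →
      (((N : ℝ) ^ d)⁻¹ * ∑ j ∈ latticeCube a N, (w j : ℝ)) *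
        (((N : ℝ) ^ d)⁻¹ * ∑ j ∈ latticeCube a N, (w j : ℝ) ^ (-1 / (q - 1))) ^ (q - 1) ≤ C)

end Muckenhoupt

section Beurling

/-- `‖A‖_𝓑 = ∑_k sup_{|i-j|_∞ ≥ |k|_∞} |a(i,j)|`, with values in `[0, ∞]`. The norm of
`Fin d → ℤ` in Mathlib is `|·|_∞`. -/
noncomputable def beurlingNorm {𝕜 : Type*} [RCLike 𝕜] {d : ℕ}
    (A : Matrix (Fin d → ℤ) (Fin d → ℤ) 𝕜) : ℝ≥0∞ :=
  ∑' k : Fin d → ℤ, ⨆ (i : Fin d → ℤ) (j : Fin d → ℤ) (_ : ‖k‖ ≤ ‖i - j‖), ‖A i j‖ₑ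

/-- The Beurling-type class `𝓑(ℤ^d, ℤ^d)` of infinite matrices. -/
def beurlingClass (𝕜 : Type*) [RCLike 𝕜] (d : ℕ) : Set (Matrix (Fin d → ℤ) (Fin d → ℤ) 𝕜) :=
  {A | beurlingNorm A < ∞}

/-- The product `(AB)(i,k) = ∑_j a(i,j) b(j,k)` of infinite matrices (meaningful if these sums
converge). -/
noncomputable def infMatrixMul {𝕜 : Type*} [RCLike 𝕜] {ι : Type*} (A B : Matrix ι ι 𝕜) :
    Matrix ι ι 𝕜 :=
  Matrix.of fun i k => ∑' j, A i j * B j k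

/-- The bounded operator `T` on `ℓ^q_w` is the one given by the infinite matrix `A`, that is,
`(Tc)(i) = ∑_j a(i,j) c(j)` with (absolutely) convergent sums. -/
def IsOperatorOf {𝕜 : Type*} [RCLike 𝕜] {ι : Type*} {q : ℝ} [Fact (1 ≤ q)] {w : PosSeq ι}
    (A : Matrix ι ι 𝕜) (T : WeightedLq 𝕜 q w →L[𝕜] WeightedLq 𝕜 q w) : Prop :=
  ∀ (c : WeightedLq 𝕜 q w) (i : ι), HasSum (fun j => A i j * c j) (T c i)

/-- A subalgebra `S` of `R` is inverse-closed if the inverse of an element of `S`, whenever it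
exists in `R`, belongs to `S`. -/
def Subalgebra.IsInverseClosed {𝕜 R : Type*} [CommSemiring 𝕜] [Semiring R] [Algebra 𝕜 R]
    (S : Subalgebra 𝕜 R) : Prop :=
  ∀ a ∈ S, ∀ b : R, a * b = 1 → b * a = 1 → b ∈ S

end Beurling

/-! A matrix lies in the Beurling class exactly when its entries are dominated by F(|i-j|_∞) with F
antitone and summable over ℤ^d (`mem_beurlingClass_iff`), so every estimate reduces to convolution
with radial profiles. The convolution of two profiles is dominated by a third, because |i-j| or
|j-k| is at least half of |i-k|; this gives the algebra property. Convolution with F is a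
superposition of ball averages, which an A_q-weight makes bounded on ℓ^q_w uniformly in the radius;
this gives boundedness (`BallMeanBound.lqNorm_profileConv_le`).

For inverse-closedness, an inverse U of T gives ‖c‖ ≤ M‖Tc‖ with M = ‖U‖. This is applied to ψc,
where ψ is a cutoff at scale N around a point n. The commutator of A with ψ is small for large N,
since ψ varies at rate 1/N and the tail of the profile of A is small. Division by w(B(n,N))^{1/q}
and doubling remove the weight: if Tc is the unit sequence at k, the local means x of c satisfy x ≤
b(|·-k|) + V * x, with profiles b and V independent of k and the sum of V as small as desired
(`HasProfile.localMean_le`, `exists_scale`).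

Iteration bounds x by a Neumann series of profiles; the remainder disappears because convolution
with V contracts ℓ^q_w. Hence all columns of the inverse share one summable profile, the matrix B
formed by them lies in the class, and AB = I identifies its operator with U. -/

/-! ### Sup-norm, balls and double counting on ℤ^d. -/

section Lattice

/-- The norm `|k|_∞` of a lattice point, as a natural number. -/
def latticeNorm {d : ℕ} (k : Fin d → ℤ) : ℕ := Finset.univ.sup fun m => (k m).natAbs

variable {d : ℕ}

theorem latticeNorm_le_iff {k : Fin d → ℤ} {r : ℕ} :
    latticeNorm k ≤ r ↔ ∀ m, (k m).natAbs ≤ r := by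
  simp [latticeNorm]

theorem natAbs_le_latticeNorm (k : Fin d → ℤ) (m : Fin d) : (k m).natAbs ≤ latticeNorm k :=
  latticeNorm_le_iff.1 le_rfl m

theorem latticeNorm_zero : latticeNorm (0 : Fin d → ℤ) = 0 :=
  Nat.le_zero.1 (latticeNorm_le_iff.2 fun m => by simp)

theorem latticeNorm_eq_zero {k : Fin d → ℤ} (h : latticeNorm k = 0) : k = 0 := by
  funext m
  have := latticeNorm_le_iff.1 h.le m
  simpa using this

theorem latticeNorm_neg (k : Fin d → ℤ) : latticeNorm (-k) = latticeNorm k := by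
  simp [latticeNorm]

theorem latticeNorm_sub_comm (j k : Fin d → ℤ) : latticeNorm (j - k) = latticeNorm (k - j) := by
  rw [← latticeNorm_neg, neg_sub]

theorem latticeNorm_sub_le (i j k : Fin d → ℤ) :
    latticeNorm (i - k) ≤ latticeNorm (i - j) + latticeNorm (j - k) := by
  refine latticeNorm_le_iff.2 fun m => ?_
  have h1 := natAbs_le_latticeNorm (i - j) m
  have h2 := natAbs_le_latticeNorm (j - k) m
  simp only [Pi.sub_apply] at *
  omega

theorem latticeNorm_const [NeZero d] (r : ℕ) : latticeNorm (fun _ : Fin d => (r : ℤ)) = r := by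
  refine le_antisymm (latticeNorm_le_iff.2 fun m => by simp) ?_
  simpa using natAbs_le_latticeNorm (fun _ : Fin d => (r : ℤ)) 0

theorem norm_eq_latticeNorm (k : Fin d → ℤ) : ‖k‖ = (latticeNorm k : ℝ) := by
  refine le_antisymm ((pi_norm_le_iff_of_nonneg (Nat.cast_nonneg _)).2 fun m => ?_) ?_
  · rw [Int.norm_eq_abs, ← Int.cast_abs, Int.abs_eq_natAbs, Int.cast_natCast]
    exact_mod_cast natAbs_le_latticeNorm k m
  · have h : latticeNorm k ≤ ⌊‖k‖⌋₊ := by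
      refine latticeNorm_le_iff.2 fun m => Nat.le_floor ?_
      have := norm_le_pi_norm k m
      rwa [Int.norm_eq_abs, ← Int.cast_abs, Int.abs_eq_natAbs, Int.cast_natCast] at this
    exact (Nat.le_floor_iff (norm_nonneg k)).1 h

/-- The ball of radius `R` for `|·|_∞` in `ℤ^d`. -/
noncomputable def latticeBall (a : Fin d → ℤ) (R : ℕ) : Finset (Fin d → ℤ) :=
  latticeCube (fun m => a m - R) (2 * R + 1)

theorem mem_latticeBall {a j : Fin d → ℤ} {R : ℕ} :
    j ∈ latticeBall a R ↔ latticeNorm (j - a) ≤ R := by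
  simp only [latticeBall, latticeCube, Fintype.mem_piFinset, Finset.mem_Ico, latticeNorm_le_iff,
    Pi.sub_apply]
  refine forall_congr' fun m => ?_
  push_cast
  omega

theorem mem_latticeBall_comm {a j : Fin d → ℤ} {R : ℕ} :
    j ∈ latticeBall a R ↔ a ∈ latticeBall j R := by
  rw [mem_latticeBall, mem_latticeBall, latticeNorm_sub_comm]

theorem card_latticeBall (a : Fin d → ℤ) (R : ℕ) : (latticeBall a R).card = (2 * R + 1) ^ d := by
  rw [latticeBall, latticeCube, Fintype.card_piFinset]
  simp only [Int.card_Ico]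
  rw [Finset.prod_congr rfl (g := fun _ => 2 * R + 1) (fun m _ => by omega)]
  simp

theorem self_mem_latticeBall (a : Fin d → ℤ) (R : ℕ) : a ∈ latticeBall a R := by
  rw [mem_latticeBall, sub_self, latticeNorm_zero]; exact Nat.zero_le _

theorem latticeBall_subset {a b : Fin d → ℤ} {R R' : ℕ} (h : latticeNorm (a - b) + R ≤ R') :
    latticeBall a R ⊆ latticeBall b R' := by
  intro j hj
  rw [mem_latticeBall] at hj ⊢
  have := latticeNorm_sub_le j a b
  omega

theorem sum_latticeBall_eq_tsum (a : Fin d → ℤ) (R : ℕ) (f : (Fin d → ℤ) → ℝ≥0∞) :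
    ∑ j ∈ latticeBall a R, f j = ∑' j, if j ∈ latticeBall a R then f j else 0 := by
  rw [tsum_eq_sum (s := latticeBall a R) (fun j hj => by simp [hj])]
  exact Finset.sum_congr rfl fun j hj => by simp [hj]

/-- Double counting of the pairs of lattice points of distance at most `R`. -/
theorem tsum_sum_latticeBall_comm (R : ℕ) (f : (Fin d → ℤ) → (Fin d → ℤ) → ℝ≥0∞) :
    ∑' i, ∑ j ∈ latticeBall i R, f i j = ∑' j, ∑ i ∈ latticeBall j R, f i j := by
  simp only [sum_latticeBall_eq_tsum]
  rw [ENNReal.tsum_comm]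
  refine tsum_congr fun j => tsum_congr fun i => ?_
  simp only [mem_latticeBall_comm (a := i)]

end Lattice

/-! ### Radial profiles: convolution, sums and Neumann series. -/

section Profile

/-- The sum over `ℤ^d` of the radial function with profile `F`. -/
noncomputable def profileSum (d : ℕ) (F : ℕ → ℝ≥0∞) : ℝ≥0∞ :=
  ∑' k : Fin d → ℤ, F (latticeNorm k)

/-- Convolution on `ℤ^d` with the radial function with profile `F`. -/
noncomputable def profileConv {d : ℕ} (F : ℕ → ℝ≥0∞) (c : (Fin d → ℤ) → ℝ≥0∞) (i : Fin d → ℤ) :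
    ℝ≥0∞ :=
  ∑' j, F (latticeNorm (i - j)) * c j

/-- An antitone profile dominating the convolution of the profiles `F` and `G`. -/
noncomputable def profileMul (d : ℕ) (F G : ℕ → ℝ≥0∞) (r : ℕ) : ℝ≥0∞ :=
  F (r / 2) * profileSum d G + profileSum d F * G (r / 2)

variable {d : ℕ}

theorem profileSum_mono {F G : ℕ → ℝ≥0∞} (h : ∀ r, F r ≤ G r) :
    profileSum d F ≤ profileSum d G :=
  ENNReal.tsum_le_tsum fun _ => h _

theorem profileSum_add (F G : ℕ → ℝ≥0∞) :
    profileSum d (fun r => F r + G r) = profileSum d F + profileSum d G :=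
  ENNReal.tsum_add

theorem profileSum_const_mul (t : ℝ≥0∞) (F : ℕ → ℝ≥0∞) :
    profileSum d (fun r => t * F r) = t * profileSum d F :=
  ENNReal.tsum_mul_left

theorem tsum_sub_left_eq_profileSum (F : ℕ → ℝ≥0∞) (i : Fin d → ℤ) :
    ∑' j, F (latticeNorm (i - j)) = profileSum d F :=
  (Equiv.subLeft i).tsum_eq fun k => F (latticeNorm k)

theorem tsum_sub_right_eq_profileSum (F : ℕ → ℝ≥0∞) (i : Fin d → ℤ) :
    ∑' j, F (latticeNorm (j - i)) = profileSum d F :=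
  (Equiv.subRight i).tsum_eq fun k => F (latticeNorm k)

theorem profileSum_indicator (R : ℕ) :
    profileSum d (fun r => if r ≤ R then 1 else 0) = ((2 * R + 1) ^ d : ℕ) := by
  have h := sum_latticeBall_eq_tsum (0 : Fin d → ℤ) R fun _ => 1
  simp only [mem_latticeBall, sub_zero] at h
  rw [profileSum, ← h, Finset.sum_const, card_latticeBall, nsmul_eq_mul, mul_one]

/-- Coordinatewise division with remainder by D is injective. Truncated division commutes with
absolute values, so the quotient has norm exactly |k|/D, and the remainder is one of at most
(2D+1)^d points. -/
theorem profileSum_comp_div_le (F : ℕ → ℝ≥0∞) {D : ℕ} (hD : D ≠ 0) :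
    profileSum d (fun r => F (r / D)) ≤ ((2 * D + 1) ^ d : ℕ) * profileSum d F := by
  have hq : ∀ k : Fin d → ℤ, latticeNorm (fun m => (k m).tdiv D) = latticeNorm k / D := by
    intro k
    refine le_antisymm (latticeNorm_le_iff.2 fun m => ?_) ?_
    · rw [Int.natAbs_tdiv, Int.natAbs_natCast]
      exact Nat.div_le_div_right (natAbs_le_latticeNorm k m)
    · refine Nat.le_of_lt_succ ((Nat.div_lt_iff_lt_mul (Nat.pos_of_ne_zero hD)).2 ?_)
      refine Nat.lt_of_le_pred (by positivity) (latticeNorm_le_iff.2 fun m => ?_)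
      refine Nat.le_pred_of_lt ((Nat.div_lt_iff_lt_mul (Nat.pos_of_ne_zero hD)).1 ?_)
      have := natAbs_le_latticeNorm (fun m => (k m).tdiv D) m
      rw [Int.natAbs_tdiv, Int.natAbs_natCast] at this
      exact Nat.lt_succ_of_le this
  have hr : ∀ k : Fin d → ℤ, (fun m => (k m).tmod D) ∈ latticeBall (0 : Fin d → ℤ) D := by
    intro k
    rw [mem_latticeBall, sub_zero]
    refine latticeNorm_le_iff.2 fun m => ?_
    rw [Int.natAbs_tmod, Int.natAbs_natCast]
    exact (Nat.mod_lt _ (Nat.pos_of_ne_zero hD)).le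
  let φ : (Fin d → ℤ) → (Fin d → ℤ) × latticeBall (0 : Fin d → ℤ) D :=
    fun k => (fun m => (k m).tdiv D, ⟨fun m => (k m).tmod D, hr k⟩)
  have hφ : Function.Injective φ := by
    intro k l h
    simp only [φ, Prod.mk.injEq, Subtype.mk.injEq] at h
    funext m
    rw [← Int.mul_tdiv_add_tmod (k m) D, ← Int.mul_tdiv_add_tmod (l m) D, congrFun h.1 m,
      congrFun h.2 m]
  calc profileSum d (fun r => F (r / D))
      = ∑' k, (fun p : (Fin d → ℤ) × latticeBall (0 : Fin d → ℤ) D => F (latticeNorm p.1)) (φ k) :=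
        tsum_congr fun k => by simp only [φ, hq]
    _ ≤ ∑' p : (Fin d → ℤ) × latticeBall (0 : Fin d → ℤ) D, F (latticeNorm p.1) :=
        ENNReal.tsum_comp_le_tsum_of_injective hφ _
    _ = ((2 * D + 1) ^ d : ℕ) * profileSum d F := by
        rw [ENNReal.tsum_prod']
        simp only [tsum_fintype, Finset.sum_const, Finset.card_univ, Fintype.card_coe,
          card_latticeBall, nsmul_eq_mul]
        rw [ENNReal.tsum_mul_left, profileSum]

theorem profileMul_antitone {F G : ℕ → ℝ≥0∞} (hF : Antitone F) (hG : Antitone G) :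
    Antitone (profileMul d F G) := fun r s h => by
  have h2 : r / 2 ≤ s / 2 := Nat.div_le_div_right h
  exact add_le_add (mul_le_mul_left (hF h2) _) (mul_le_mul_right (hG h2) _)

/-- Submultiplicativity up to a constant: each of the two halved profiles costs 5^d = (2·2+1)^d. -/
theorem profileSum_profileMul_le (F G : ℕ → ℝ≥0∞) :
    profileSum d (profileMul d F G) ≤
      (2 * (5 ^ d : ℕ)) * (profileSum d F * profileSum d G) := by
  have h : ∀ F : ℕ → ℝ≥0∞, profileSum d (fun r => F (r / 2)) ≤ (5 ^ d : ℕ) * profileSum d F :=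
    fun F => profileSum_comp_div_le F two_ne_zero
  calc profileSum d (profileMul d F G)
      = profileSum d G * profileSum d (fun r => F (r / 2))
          + profileSum d F * profileSum d (fun r => G (r / 2)) := by
        rw [← profileSum_const_mul, ← profileSum_const_mul, ← profileSum_add]
        refine congrArg (profileSum d) (funext fun r => ?_)
        rw [profileMul, mul_comm]
    _ ≤ profileSum d G * ((5 ^ d : ℕ) * profileSum d F)
          + profileSum d F * ((5 ^ d : ℕ) * profileSum d G) :=
        add_le_add (mul_le_mul_right (h F) _) (mul_le_mul_right (h G) _)
    _ = _ := by ring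

/-- By the triangle inequality, |i-j| or |j-k| is at least |i-k|/2; the corresponding antitone
factor is frozen there and the other one is summed. -/
theorem profileConv_profile_le {F G : ℕ → ℝ≥0∞} (hF : Antitone F) (hG : Antitone G)
    (i k : Fin d → ℤ) :
    ∑' j, F (latticeNorm (i - j)) * G (latticeNorm (j - k)) ≤
      profileMul d F G (latticeNorm (i - k)) := by
  calc ∑' j, F (latticeNorm (i - j)) * G (latticeNorm (j - k))
      ≤ ∑' j, (F (latticeNorm (i - k) / 2) * G (latticeNorm (j - k))
          + F (latticeNorm (i - j)) * G (latticeNorm (i - k) / 2)) := by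
        refine ENNReal.tsum_le_tsum fun j => ?_
        have h := latticeNorm_sub_le i j k
        rcases le_total (latticeNorm (i - k) / 2) (latticeNorm (i - j)) with h1 | h1
        · exact le_add_right (mul_le_mul_left (hF h1) _)
        · exact le_add_left (mul_le_mul_right (hG (by omega)) _)
    _ = profileMul d F G (latticeNorm (i - k)) := by
        rw [ENNReal.tsum_add, ENNReal.tsum_mul_left, ENNReal.tsum_mul_right,
          tsum_sub_right_eq_profileSum, tsum_sub_left_eq_profileSum, profileMul]

/-- The diagonal points (r,…,r) have norm r and are distinct, as d ≥ 1. Summability over ℤ^d thus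
forces F to be bounded and to vanish at infinity. -/
theorem tsum_le_profileSum [NeZero d] (F : ℕ → ℝ≥0∞) : ∑' r, F r ≤ profileSum d F := by
  have h : Function.Injective fun (r : ℕ) (_ : Fin d) => (r : ℤ) := fun r s h => by
    simpa using congrFun h 0
  refine le_trans (le_of_eq ?_) (ENNReal.tsum_comp_le_tsum_of_injective h _)
  exact tsum_congr fun r => by rw [latticeNorm_const]

theorem tendsto_zero_of_profileSum_ne_top [NeZero d] {F : ℕ → ℝ≥0∞} (h : profileSum d F ≠ ∞) :
    Filter.Tendsto F Filter.atTop (nhds 0) :=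
  ENNReal.tendsto_atTop_zero_of_tsum_ne_top (ne_top_of_le_ne_top h (tsum_le_profileSum F))

theorem profile_le_profileSum [NeZero d] (F : ℕ → ℝ≥0∞) (r : ℕ) : F r ≤ profileSum d F :=
  (ENNReal.le_tsum r).trans (tsum_le_profileSum F)

/-- Dominated convergence for the counting measure: F(max(|k|, L)) is below F(|k|) and tends to 0
with F(L). -/
theorem tendsto_profileSum_max [NeZero d] {F : ℕ → ℝ≥0∞} (hF : Antitone F)
    (h : profileSum d F ≠ ∞) :
    Filter.Tendsto (fun L => profileSum d fun r => F (max r L)) Filter.atTop (nhds 0) := by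
  let : MeasurableSpace (Fin d → ℤ) := ⊤
  have key := MeasureTheory.tendsto_lintegral_of_dominated_convergence
    (μ := MeasureTheory.Measure.count)
    (F := fun (L : ℕ) (k : Fin d → ℤ) => F (max (latticeNorm k) L)) (f := fun _ => 0)
    (fun k => F (latticeNorm k)) (fun L => measurable_from_top)
    (fun L => Filter.Eventually.of_forall fun k => hF (le_max_left _ _))
    (by rw [MeasureTheory.lintegral_count]; exact h)
    (Filter.Eventually.of_forall fun k => by
      refine tendsto_of_tendsto_of_tendsto_of_le_of_le tendsto_const_nhds
        (tendsto_zero_of_profileSum_ne_top h) (fun _ => zero_le) fun L => hF (le_max_right _ _))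
  simpa only [MeasureTheory.lintegral_count, MeasureTheory.lintegral_zero, profileSum] using key

theorem profileConv_mono {F : ℕ → ℝ≥0∞} {c c' : (Fin d → ℤ) → ℝ≥0∞} (h : ∀ j, c j ≤ c' j)
    (i : Fin d → ℤ) : profileConv F c i ≤ profileConv F c' i :=
  ENNReal.tsum_le_tsum fun j => mul_le_mul_right (h j) _

theorem profileConv_add (F : ℕ → ℝ≥0∞) (c c' : (Fin d → ℤ) → ℝ≥0∞) (i : Fin d → ℤ) :
    profileConv F (fun j => c j + c' j) i = profileConv F c i + profileConv F c' i := by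
  simp only [profileConv, mul_add, ENNReal.tsum_add]

/-- The profiles of the terms `V^n b` of a Neumann series. -/
noncomputable def profileIter (d : ℕ) (V b : ℕ → ℝ≥0∞) : ℕ → ℕ → ℝ≥0∞
  | 0 => b
  | n + 1 => profileMul d V (profileIter d V b n)

theorem profileIter_antitone {V b : ℕ → ℝ≥0∞} (hV : Antitone V) (hb : Antitone b) (n : ℕ) :
    Antitone (profileIter d V b n) := by
  induction n with
  | zero => exact hb
  | succ n ih => exact profileMul_antitone hV ih

theorem profileSum_profileIter_le {V b : ℕ → ℝ≥0∞}
    (hVs : (2 * (5 ^ d : ℕ)) * profileSum d V ≤ 2⁻¹) (n : ℕ) :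
    profileSum d (profileIter d V b n) ≤ 2⁻¹ ^ n * profileSum d b := by
  induction n with
  | zero => simp [profileIter]
  | succ n ih =>
    calc profileSum d (profileIter d V b (n + 1))
        ≤ (2 * (5 ^ d : ℕ)) * profileSum d V * profileSum d (profileIter d V b n) := by
          rw [mul_assoc]; exact profileSum_profileMul_le _ _
      _ ≤ 2⁻¹ * (2⁻¹ ^ n * profileSum d b) := mul_le_mul' hVs ih
      _ = _ := by ring

/-- The profile of the Neumann series `∑ V^n b`. -/
noncomputable def profileNeumann (d : ℕ) (V b : ℕ → ℝ≥0∞) (r : ℕ) : ℝ≥0∞ :=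
  ∑' n, profileIter d V b n r

theorem profileNeumann_antitone {V b : ℕ → ℝ≥0∞} (hV : Antitone V) (hb : Antitone b) :
    Antitone (profileNeumann d V b) := fun _ _ h =>
  ENNReal.tsum_le_tsum fun n => profileIter_antitone hV hb n h

theorem profileSum_profileNeumann_le {V b : ℕ → ℝ≥0∞}
    (hVs : (2 * (5 ^ d : ℕ)) * profileSum d V ≤ 2⁻¹) :
    profileSum d (profileNeumann d V b) ≤ 2 * profileSum d b := by
  calc profileSum d (profileNeumann d V b)
      = ∑' n, profileSum d (profileIter d V b n) := ENNReal.tsum_comm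
    _ ≤ ∑' n, 2⁻¹ ^ n * profileSum d b := ENNReal.tsum_le_tsum (profileSum_profileIter_le hVs)
    _ = 2 * profileSum d b := by
        rw [ENNReal.tsum_mul_right, ENNReal.tsum_geometric, ENNReal.one_sub_inv_two, inv_inv]

/-- Iterating `x ≤ b + V * x`, with the remainder still present. -/
theorem le_sum_profileIter_add {V b : ℕ → ℝ≥0∞} (hV : Antitone V) (hb : Antitone b)
    {x : (Fin d → ℤ) → ℝ≥0∞} {k : Fin d → ℤ}
    (hx : ∀ i, x i ≤ b (latticeNorm (i - k)) + profileConv V x i) (n : ℕ) (i : Fin d → ℤ) :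
    x i ≤ (∑ m ∈ Finset.range n, profileIter d V b m (latticeNorm (i - k)))
      + (profileConv V)^[n] x i := by
  have conv_le : ∀ (m : ℕ) i, profileConv V
      (fun j => profileIter d V b m (latticeNorm (j - k))) i
        ≤ profileIter d V b (m + 1) (latticeNorm (i - k)) := fun m i =>
    profileConv_profile_le hV (profileIter_antitone hV hb m) i k
  -- The hypothesis `hx` after n convolutions with V: the source term is absorbed into the n-th
  -- iterated profile.
  have main : ∀ n i, (profileConv V)^[n] x i ≤
      profileIter d V b n (latticeNorm (i - k)) + (profileConv V)^[n + 1] x i := by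
    intro n
    induction n with
    | zero => exact hx
    | succ n ih =>
      intro i
      rw [Function.iterate_succ_apply', Function.iterate_succ_apply' _ (n + 1)]
      refine (profileConv_mono ih i).trans ?_
      rw [profileConv_add]
      exact add_le_add_left (conv_le n i) _
  induction n with
  | zero => simp
  | succ n ih =>
    rw [Finset.sum_range_succ, add_assoc]
    exact ih.trans (add_le_add_right (main n i) _)

/-- The inequality alone does not determine x, which could be infinite; `hlim` excludes this by
removing the remainder. -/
theorem le_profileNeumann {V b : ℕ → ℝ≥0∞} (hV : Antitone V) (hb : Antitone b)
    {x : (Fin d → ℤ) → ℝ≥0∞} {k : Fin d → ℤ}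
    (hx : ∀ i, x i ≤ b (latticeNorm (i - k)) + profileConv V x i) (i : Fin d → ℤ)
    (hlim : Filter.Tendsto (fun n => (profileConv V)^[n] x i) Filter.atTop (nhds 0)) :
    x i ≤ profileNeumann d V b (latticeNorm (i - k)) := by
  have h : Filter.Tendsto (fun n => profileNeumann d V b (latticeNorm (i - k))
      + (profileConv V)^[n] x i) Filter.atTop
      (nhds (profileNeumann d V b (latticeNorm (i - k)) + 0)) := tendsto_const_nhds.add hlim
  rw [add_zero] at h
  exact ge_of_tendsto' h fun n => (le_sum_profileIter_add hV hb hx n i).trans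
    (add_le_add_left (ENNReal.sum_le_tsum _) _)

end Profile

/-! ### Weighted ℓ^q-norms of sequences with values in [0, ∞]. -/

section WeightedNorm

/-- The values of a positive sequence in `[0, ∞]`. -/
noncomputable def PosSeq.weight {ι : Type*} (w : PosSeq ι) (i : ι) : ℝ≥0∞ :=
  ENNReal.ofReal (w i : ℝ)

theorem PosSeq.weight_ne_zero {ι : Type*} (w : PosSeq ι) (i : ι) : w.weight i ≠ 0 := by
  simpa [PosSeq.weight] using (w i).2

theorem PosSeq.weight_ne_top {ι : Type*} (w : PosSeq ι) (i : ι) : w.weight i ≠ ∞ :=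
  ENNReal.ofReal_ne_top

/-- The weighted `ℓ^q`-norm of a sequence with values in `[0, ∞]`. -/
noncomputable def lqNorm {ι : Type*} (q : ℝ) (w : PosSeq ι) (c : ι → ℝ≥0∞) : ℝ≥0∞ :=
  (∑' i, c i ^ q * w.weight i) ^ q⁻¹

variable {ι : Type*} {q : ℝ} {w : PosSeq ι}

theorem lqNorm_rpow (hq : 1 ≤ q) (c : ι → ℝ≥0∞) :
    lqNorm q w c ^ q = ∑' i, c i ^ q * w.weight i := by
  rw [lqNorm, ENNReal.rpow_inv_rpow (by linarith)]

theorem lqNorm_le_iff (hq : 1 ≤ q) {c : ι → ℝ≥0∞} {t : ℝ≥0∞} :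
    lqNorm q w c ≤ t ↔ ∑' i, c i ^ q * w.weight i ≤ t ^ q :=
  ENNReal.rpow_inv_le_iff (by linarith)

theorem lqNorm_mono (hq : 1 ≤ q) {c c' : ι → ℝ≥0∞} (h : ∀ i, c i ≤ c' i) :
    lqNorm q w c ≤ lqNorm q w c' :=
  ENNReal.rpow_le_rpow (ENNReal.tsum_le_tsum fun i =>
    mul_le_mul_left (ENNReal.rpow_le_rpow (h i) (by linarith)) _) (by positivity)

theorem lqNorm_const_mul (hq : 1 ≤ q) (t : ℝ≥0∞) (c : ι → ℝ≥0∞) :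
    lqNorm q w (fun i => t * c i) = t * lqNorm q w c := by
  have hq0 : 0 ≤ q := by linarith
  rw [lqNorm, lqNorm]
  simp only [ENNReal.mul_rpow_of_nonneg _ _ hq0, mul_assoc, ENNReal.tsum_mul_left]
  rw [ENNReal.mul_rpow_of_nonneg _ _ (inv_nonneg.2 hq0), ENNReal.rpow_rpow_inv (by linarith)]

theorem lqNorm_add_le (hq : 1 ≤ q) (c c' : ι → ℝ≥0∞) :
    lqNorm q w (fun i => c i + c' i) ≤ lqNorm q w c + lqNorm q w c' := by
  have hq0 : 0 < q := by linarith
  have hpow : ∀ (x : ℝ≥0∞) i, (x * w.weight i ^ q⁻¹) ^ q = x ^ q * w.weight i := fun x i => by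
    rw [ENNReal.mul_rpow_of_nonneg _ _ hq0.le, ENNReal.rpow_inv_rpow hq0.ne']
  have hle : ∀ (s : Finset ι) (a : ι → ℝ≥0∞),
      (∑ i ∈ s, a i ^ q * w.weight i) ^ q⁻¹ ≤ lqNorm q w a := fun s a =>
    ENNReal.rpow_le_rpow (ENNReal.sum_le_tsum s) (by positivity)
  rw [lqNorm_le_iff hq, ENNReal.tsum_eq_iSup_sum]
  refine iSup_le fun s => ?_
  rw [← ENNReal.rpow_inv_le_iff hq0]
  have h := ENNReal.Lp_add_le s (fun i => c i * w.weight i ^ q⁻¹)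
    (fun i => c' i * w.weight i ^ q⁻¹) hq
  simp only [← add_mul, hpow, one_div] at h
  exact h.trans (add_le_add (hle s c) (hle s c'))

theorem lqNorm_zero (hq : 1 ≤ q) : lqNorm q w (fun _ => 0) = 0 := by
  have hq0 : 0 < q := by linarith
  simp [lqNorm, ENNReal.zero_rpow_of_pos, hq0]

theorem lqNorm_sum_le (hq : 1 ≤ q) {κ : Type*} (s : Finset κ) (c : κ → ι → ℝ≥0∞) :
    lqNorm q w (fun i => ∑ m ∈ s, c m i) ≤ ∑ m ∈ s, lqNorm q w (c m) := by
  classical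
  induction s using Finset.induction_on with
  | empty => simp [lqNorm_zero hq]
  | insert m s hm ih =>
    simp only [Finset.sum_insert hm]
    exact (lqNorm_add_le hq _ _).trans (add_le_add_right ih _)

theorem le_lqNorm (hq : 1 ≤ q) (c : ι → ℝ≥0∞) (i : ι) :
    c i * w.weight i ^ q⁻¹ ≤ lqNorm q w c := by
  have hq0 : 0 < q := by linarith
  rw [lqNorm, ENNReal.le_rpow_inv_iff hq0, ENNReal.mul_rpow_of_nonneg _ _ hq0.le,
    ENNReal.rpow_inv_rpow hq0.ne']
  exact ENNReal.le_tsum (f := fun i => c i ^ q * w.weight i) i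

theorem PosSeq.weight_rpow_ne_zero (w : PosSeq ι) (hq : 1 ≤ q) (i : ι) :
    w.weight i ^ q⁻¹ ≠ 0 := by
  have : 0 < q := by linarith
  simp [ENNReal.rpow_eq_zero_iff, w.weight_ne_zero, w.weight_ne_top]

theorem ne_top_of_lqNorm_ne_top (hq : 1 ≤ q) {c : ι → ℝ≥0∞} (h : lqNorm q w c ≠ ∞) (i : ι) :
    c i ≠ ∞ := fun hi => by
  have := le_lqNorm (w := w) hq c i
  rw [hi, ENNReal.top_mul (w.weight_rpow_ne_zero hq i)] at this
  exact h (top_le_iff.1 this)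

theorem tendsto_zero_of_lqNorm (hq : 1 ≤ q) {c : ℕ → ι → ℝ≥0∞}
    (h : Filter.Tendsto (fun n => lqNorm q w (c n)) Filter.atTop (nhds 0)) (i : ι) :
    Filter.Tendsto (fun n => c n i) Filter.atTop (nhds 0) := by
  have hw0 := w.weight_rpow_ne_zero hq i
  have hwt : w.weight i ^ q⁻¹ ≠ ∞ :=
    ENNReal.rpow_ne_top_of_nonneg (inv_nonneg.2 (by linarith)) (w.weight_ne_top i)
  have h' : Filter.Tendsto (fun n => lqNorm q w (c n) * (w.weight i ^ q⁻¹)⁻¹) Filter.atTop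
      (nhds (0 * (w.weight i ^ q⁻¹)⁻¹)) :=
    ENNReal.Tendsto.mul_const h (Or.inr (ENNReal.inv_ne_top.2 hw0))
  rw [zero_mul] at h'
  refine tendsto_of_tendsto_of_tendsto_of_le_of_le tendsto_const_nhds h' (fun _ => zero_le)
    fun n => ?_
  rw [← div_eq_mul_inv]
  exact (ENNReal.le_div_iff_mul_le (Or.inl hw0) (Or.inl hwt)).2 (le_lqNorm hq _ i)

/-- Jensen's inequality for t^q with the masses a(i), in unnormalized form; it follows from the
weighted Hölder inequality on finite sets. -/
theorem ENNReal.rpow_tsum_mul_le (hq : 1 ≤ q) (a x : ι → ℝ≥0∞) :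
    (∑' i, a i * x i) ^ q ≤ (∑' i, a i) ^ (q - 1) * ∑' i, a i * x i ^ q := by
  have hq0 : 0 < q := by linarith
  have h1 : 0 ≤ 1 - q⁻¹ := sub_nonneg.2 (inv_le_one_of_one_le₀ hq)
  have h : ∑' i, a i * x i ≤ (∑' i, a i) ^ (1 - q⁻¹) * (∑' i, a i * x i ^ q) ^ q⁻¹ := by
    rw [ENNReal.tsum_eq_iSup_sum]
    refine iSup_le fun s => (ENNReal.inner_le_weight_mul_Lp_of_nonneg s hq a x).trans ?_
    exact mul_le_mul' (ENNReal.rpow_le_rpow (ENNReal.sum_le_tsum s) h1)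
      (ENNReal.rpow_le_rpow (ENNReal.sum_le_tsum s) (by positivity))
  refine (ENNReal.rpow_le_rpow h hq0.le).trans_eq ?_
  rw [ENNReal.mul_rpow_of_nonneg _ _ hq0.le, ENNReal.rpow_inv_rpow hq0.ne', ← ENNReal.rpow_mul]
  congr 2
  field_simp

end WeightedNorm

/-! ### Consequences of the A_q condition: doubling and uniformly bounded averages. -/

section BallMean

variable {d : ℕ} {q : ℝ} {w : PosSeq (Fin d → ℤ)} {C : ℝ≥0∞}

/-- The weighted mean value inequality on balls that characterizes `A_q`-weights. -/
def BallMeanBound (q : ℝ) (w : PosSeq (Fin d → ℤ)) (C : ℝ≥0∞) : Prop :=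
  ∀ (n : Fin d → ℤ) (R : ℕ) (c : (Fin d → ℤ) → ℝ≥0∞),
    (∑ j ∈ latticeBall n R, c j) ^ q * ∑ j ∈ latticeBall n R, w.weight j ≤
      C * (((2 * R + 1) ^ d : ℕ) : ℝ≥0∞) ^ q * ∑ j ∈ latticeBall n R, c j ^ q * w.weight j

/-- The A_q constant itself serves. For q = 1 the pointwise bound on w(B) is summed against c; for q
> 1 Hölder's inequality produces the dual weight w^{-1/(q-1)}, which the A_q condition pairs with w.
-/
theorem IsDiscreteAqWeight.exists_ballMeanBound (hw : IsDiscreteAqWeight q w) :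
    ∃ C : ℝ≥0∞, C ≠ ∞ ∧ BallMeanBound q w C := by
  rcases hw with ⟨rfl, C, hC, h⟩ | ⟨hq, C, hC, h⟩
  · refine ⟨ENNReal.ofReal C, ENNReal.ofReal_ne_top, fun n R c => ?_⟩
    simp only [ENNReal.rpow_one]
    rw [Finset.sum_mul, Finset.mul_sum]
    refine Finset.sum_le_sum fun i hi => ?_
    have hN : (0 : ℝ) < (((2 * R + 1 : ℕ) : ℝ)) ^ d := by positivity
    have key := h _ _ (Nat.le_add_left 1 (2 * R)) i hi
    rw [inv_mul_le_iff₀ hN] at key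
    have key' : ∑ j ∈ latticeBall n R, w.weight j ≤
        ENNReal.ofReal C * ((2 * R + 1) ^ d : ℕ) * w.weight i := by
      simp only [PosSeq.weight]
      rw [← ENNReal.ofReal_sum_of_nonneg fun j _ => (w j).2.le, ← ENNReal.ofReal_natCast,
        ← ENNReal.ofReal_mul hC.le, ← ENNReal.ofReal_mul (by positivity)]
      refine ENNReal.ofReal_le_ofReal (key.trans_eq ?_)
      push_cast
      ring
    calc c i * ∑ j ∈ latticeBall n R, w.weight j
        ≤ c i * (ENNReal.ofReal C * ((2 * R + 1) ^ d : ℕ) * w.weight i) :=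
          mul_le_mul_right key' _
      _ = _ := by ring
  · have hq0 : 0 < q := by linarith
    have hq1 : 0 < q - 1 := by linarith
    have hconj : q.HolderConjugate (q / (q - 1)) := Real.HolderConjugate.conjExponent hq
    refine ⟨ENNReal.ofReal C, ENNReal.ofReal_ne_top, fun n R c => ?_⟩
    set B := latticeBall n R with hB
    set σ : ℝ≥0∞ := ∑ j ∈ B, w.weight j ^ (-1 / (q - 1)) with hσ
    have hN : (0 : ℝ) < (((2 * R + 1 : ℕ) : ℝ)) ^ d := by positivity
    have hpos : ∀ j ∈ B, 0 ≤ (w j : ℝ) ^ (-1 / (q - 1)) := fun j _ =>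
      Real.rpow_nonneg (w j).2.le _
    -- Hölder for c = (c w^{1/q}) · w^{-1/q}, with dual exponent q/(q-1).
    have holder : (∑ j ∈ B, c j) ^ q ≤ (∑ j ∈ B, c j ^ q * w.weight j) * σ ^ (q - 1) := by
      have h1 := ENNReal.inner_le_Lp_mul_Lq B (fun j => c j * w.weight j ^ q⁻¹)
        (fun j => w.weight j ^ (-q⁻¹)) hconj
      have e1 : ∀ j, c j * w.weight j ^ q⁻¹ * w.weight j ^ (-q⁻¹) = c j := fun j => by
        rw [mul_assoc, ← ENNReal.rpow_add _ _ (w.weight_ne_zero j) (w.weight_ne_top j),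
          add_neg_cancel, ENNReal.rpow_zero, mul_one]
      have e2 : ∀ j, (c j * w.weight j ^ q⁻¹) ^ q = c j ^ q * w.weight j := fun j => by
        rw [ENNReal.mul_rpow_of_nonneg _ _ hq0.le, ENNReal.rpow_inv_rpow hq0.ne']
      have e3 : ∀ j, (w.weight j ^ (-q⁻¹)) ^ (q / (q - 1)) = w.weight j ^ (-1 / (q - 1)) :=
        fun j => by
          rw [← ENNReal.rpow_mul]
          congr 1
          field_simp
      simp only [e1, e2, e3] at h1
      refine (ENNReal.rpow_le_rpow h1 hq0.le).trans_eq ?_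
      rw [ENNReal.mul_rpow_of_nonneg _ _ hq0.le, one_div, ENNReal.rpow_inv_rpow hq0.ne',
        ← ENNReal.rpow_mul, one_div_div, div_mul_cancel₀ _ hq0.ne']
    have key := h (fun m => n m - R) _ (Nat.le_add_left 1 (2 * R))
    change (_ * ∑ j ∈ B, (w j : ℝ)) * (_ * ∑ j ∈ B, (w j : ℝ) ^ (-1 / (q - 1))) ^ (q - 1) ≤ C
      at key
    set N : ℝ := ((2 * R + 1 : ℕ) : ℝ) ^ d with hNdef
    have key2 : (∑ j ∈ B, (w j : ℝ)) * (∑ j ∈ B, (w j : ℝ) ^ (-1 / (q - 1))) ^ (q - 1)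
        ≤ C * N ^ q := by
      rw [Real.mul_rpow (inv_nonneg.2 hN.le) (Finset.sum_nonneg hpos)] at key
      -- The normalizations N⁻¹ and N^{-(q-1)} of the two means combine to N^{-q}.
      have e : N ^ q * (N⁻¹ * N⁻¹ ^ (q - 1)) = 1 := by
        rw [Real.inv_rpow hN.le, ← mul_inv, ← Real.rpow_one_add' hN.le (by linarith),
          add_sub_cancel, mul_inv_cancel₀ (Real.rpow_pos_of_pos hN q).ne']
      calc (∑ j ∈ B, (w j : ℝ)) * (∑ j ∈ B, (w j : ℝ) ^ (-1 / (q - 1))) ^ (q - 1)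
          = (N ^ q * (N⁻¹ * N⁻¹ ^ (q - 1))) *
            ((∑ j ∈ B, (w j : ℝ)) * (∑ j ∈ B, (w j : ℝ) ^ (-1 / (q - 1))) ^ (q - 1)) := by
            rw [e, one_mul]
        _ = N ^ q * (N⁻¹ * (∑ j ∈ B, (w j : ℝ)) *
            (N⁻¹ ^ (q - 1) * (∑ j ∈ B, (w j : ℝ) ^ (-1 / (q - 1))) ^ (q - 1))) := by ring
        _ ≤ N ^ q * C := mul_le_mul_of_nonneg_left key (Real.rpow_nonneg hN.le _)
        _ = C * N ^ q := mul_comm _ _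
    have key3 : (∑ j ∈ B, w.weight j) * σ ^ (q - 1) ≤
        ENNReal.ofReal C * (((2 * R + 1) ^ d : ℕ) : ℝ≥0∞) ^ q := by
      have e1 : σ = ENNReal.ofReal (∑ j ∈ B, (w j : ℝ) ^ (-1 / (q - 1))) := by
        rw [ENNReal.ofReal_sum_of_nonneg hpos]
        exact Finset.sum_congr rfl fun j _ => ENNReal.ofReal_rpow_of_pos (w j).2
      have e2 : ∑ j ∈ B, w.weight j = ENNReal.ofReal (∑ j ∈ B, (w j : ℝ)) :=
        (ENNReal.ofReal_sum_of_nonneg fun j _ => (w j).2.le).symm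
      have e3 : (((2 * R + 1) ^ d : ℕ) : ℝ≥0∞) = ENNReal.ofReal N := by
        rw [← ENNReal.ofReal_natCast, hNdef]; push_cast; rfl
      rw [e1, e2, e3, ENNReal.ofReal_rpow_of_nonneg (Finset.sum_nonneg hpos) hq1.le,
        ← ENNReal.ofReal_mul (Finset.sum_nonneg fun j _ => (w j).2.le),
        ENNReal.ofReal_rpow_of_pos hN, ← ENNReal.ofReal_mul hC.le]
      exact ENNReal.ofReal_le_ofReal key2
    calc (∑ j ∈ B, c j) ^ q * ∑ j ∈ B, w.weight j
        ≤ (∑ j ∈ B, c j ^ q * w.weight j) * σ ^ (q - 1) * ∑ j ∈ B, w.weight j :=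
          mul_le_mul_left holder _
      _ = ((∑ j ∈ B, w.weight j) * σ ^ (q - 1)) * ∑ j ∈ B, c j ^ q * w.weight j := by ring
      _ ≤ _ := mul_le_mul_left key3 _

/-- The weight of a ball. -/
noncomputable def ballWeight (w : PosSeq (Fin d → ℤ)) (n : Fin d → ℤ) (R : ℕ) : ℝ≥0∞ :=
  ∑ j ∈ latticeBall n R, w.weight j

theorem ballWeight_ne_top (n : Fin d → ℤ) (R : ℕ) : ballWeight w n R ≠ ∞ :=
  ENNReal.sum_ne_top.2 fun j _ => w.weight_ne_top j

theorem weight_le_ballWeight {n j : Fin d → ℤ} {R : ℕ} (h : j ∈ latticeBall n R) :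
    w.weight j ≤ ballWeight w n R :=
  Finset.single_le_sum (f := w.weight) (fun _ _ => zero_le) h

theorem ballWeight_ne_zero (n : Fin d → ℤ) (R : ℕ) : ballWeight w n R ≠ 0 := fun h =>
  w.weight_ne_zero n (le_zero_iff.1 (h ▸ weight_le_ballWeight (self_mem_latticeBall n R)))

theorem ballWeight_mono {n m : Fin d → ℤ} {R R' : ℕ} (h : latticeBall n R ⊆ latticeBall m R') :
    ballWeight w n R ≤ ballWeight w m R' :=
  Finset.sum_le_sum_of_subset h

/-- The doubling property. -/
theorem BallMeanBound.ballWeight_le (hC : BallMeanBound q w C) (hq : 1 ≤ q)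
    {n m : Fin d → ℤ} {R R' t : ℕ} (ht : 2 * R' + 1 ≤ t * (2 * R + 1))
    (h : latticeBall n R ⊆ latticeBall m R') :
    ballWeight w m R' ≤ C * ((t ^ d : ℕ) : ℝ≥0∞) ^ q * ballWeight w n R := by
  classical
  have hq0 : 0 < q := by linarith
  -- The mean bound on the large ball is tested on the indicator of the small one; t bounds the
  -- ratio of the side lengths.
  have key := hC m R' (fun j => if j ∈ latticeBall n R then 1 else 0)
  have e1 : ∑ j ∈ latticeBall m R', (if j ∈ latticeBall n R then (1 : ℝ≥0∞) else 0)
      = ((2 * R + 1) ^ d : ℕ) := by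
    rw [Finset.sum_ite_mem, Finset.inter_eq_right.2 h, Finset.sum_const, card_latticeBall,
      nsmul_eq_mul, mul_one]
  have e2 : ∑ j ∈ latticeBall m R', (if j ∈ latticeBall n R then (1 : ℝ≥0∞) else 0) ^ q
      * w.weight j = ballWeight w n R := by
    rw [ballWeight, ← Finset.inter_eq_right.2 h, ← Finset.sum_ite_mem]
    refine Finset.sum_congr rfl fun j _ => ?_
    rw [Finset.inter_eq_right.2 h]
    split_ifs
    · rw [ENNReal.one_rpow, one_mul]
    · rw [ENNReal.zero_rpow_of_pos hq0, zero_mul]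
  rw [e1, e2] at key
  set b : ℝ≥0∞ := (((2 * R + 1) ^ d : ℕ) : ℝ≥0∞) with hb
  have hb0 : b ^ q ≠ 0 := by
    rw [Ne, ENNReal.rpow_eq_zero_iff_of_pos hq0, hb, Nat.cast_eq_zero]
    positivity
  have hbt : b ^ q ≠ ∞ := ENNReal.rpow_ne_top_of_nonneg hq0.le (ENNReal.natCast_ne_top _)
  have hle : (((2 * R' + 1) ^ d : ℕ) : ℝ≥0∞) ^ q ≤ ((t ^ d : ℕ) : ℝ≥0∞) ^ q * b ^ q := by
    rw [← ENNReal.mul_rpow_of_nonneg _ _ hq0.le, hb, ← Nat.cast_mul, ← mul_pow]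
    exact ENNReal.rpow_le_rpow (Nat.cast_le.2 (Nat.pow_le_pow_left ht d)) hq0.le
  rw [← ENNReal.mul_le_mul_iff_right hb0 hbt]
  calc b ^ q * ballWeight w m R' ≤ C * (((2 * R' + 1) ^ d : ℕ) : ℝ≥0∞) ^ q * ballWeight w n R :=
        key
    _ ≤ C * (((t ^ d : ℕ) : ℝ≥0∞) ^ q * b ^ q) * ballWeight w n R :=
        mul_le_mul_left (mul_le_mul_right hle _) _
    _ = _ := by ring

/-- The constant in the uniform bound of averaging operators. -/
noncomputable def averageConst (d : ℕ) (q : ℝ) (C : ℝ≥0∞) : ℝ≥0∞ :=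
  C * (C * ((2 ^ d : ℕ) : ℝ≥0∞) ^ q)

theorem averageConst_ne_top (hq : 1 ≤ q) (hC : C ≠ ∞) : averageConst d q C ≠ ∞ :=
  ENNReal.mul_ne_top hC (ENNReal.mul_ne_top hC
    (ENNReal.rpow_ne_top_of_nonneg (by linarith) (ENNReal.natCast_ne_top _)))

/-- The mean bound at i leaves the factor w(i)/w(B(i,R)). After exchanging the sums, these factors
are summed over i in B(j,R), where doubling replaces w(B(i,R)) by w(B(j,R)); the total is bounded
independently of R. -/
theorem BallMeanBound.tsum_average_le (hC : BallMeanBound q w C) (hq : 1 ≤ q) (R : ℕ)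
    (c : (Fin d → ℤ) → ℝ≥0∞) :
    ∑' i, (∑ j ∈ latticeBall i R, c j) ^ q * w.weight i ≤
      averageConst d q C * (((2 * R + 1) ^ d : ℕ) : ℝ≥0∞) ^ q * ∑' j, c j ^ q * w.weight j := by
  set b : ℝ≥0∞ := (((2 * R + 1) ^ d : ℕ) : ℝ≥0∞) ^ q with hb
  have h1 : ∀ i, (∑ j ∈ latticeBall i R, c j) ^ q * w.weight i ≤
      ∑ j ∈ latticeBall i R, C * b * (w.weight i / ballWeight w i R) * (c j ^ q * w.weight j) := by
    intro i
    have := hC i R c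
    rw [← hb, ← ballWeight,
      ← ENNReal.le_div_iff_mul_le (Or.inl (ballWeight_ne_zero i R))
        (Or.inl (ballWeight_ne_top i R))] at this
    refine (mul_le_mul_left this _).trans_eq ?_
    rw [← Finset.mul_sum]
    simp only [div_eq_mul_inv]
    ring
  have h2 : ∀ j, ∑ i ∈ latticeBall j R, w.weight i / ballWeight w i R
      ≤ C * ((2 ^ d : ℕ) : ℝ≥0∞) ^ q := by
    intro j
    have h3 : ∀ i ∈ latticeBall j R, w.weight i / ballWeight w i R ≤
        C * ((2 ^ d : ℕ) : ℝ≥0∞) ^ q / ballWeight w j R * w.weight i := by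
      intro i hi
      -- B(j,R) lies in B(i,2R), and 2(2R)+1 ≤ 2(2R+1) allows the doubling ratio 2.
      have h4 : ballWeight w j R ≤ C * ((2 ^ d : ℕ) : ℝ≥0∞) ^ q * ballWeight w i R := by
        refine (ballWeight_mono (latticeBall_subset (b := i) (R' := 2 * R) ?_)).trans
          (hC.ballWeight_le hq (n := i) (by omega) (latticeBall_subset ?_))
        · rw [mem_latticeBall, latticeNorm_sub_comm] at hi
          omega
        · rw [sub_self, latticeNorm_zero]
          omega
      rw [ENNReal.div_le_iff (ballWeight_ne_zero i R) (ballWeight_ne_top i R)]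
      calc w.weight i = ballWeight w j R / ballWeight w j R * w.weight i := by
            rw [ENNReal.div_self (ballWeight_ne_zero j R) (ballWeight_ne_top j R), one_mul]
        _ ≤ C * ((2 ^ d : ℕ) : ℝ≥0∞) ^ q * ballWeight w i R / ballWeight w j R * w.weight i :=
            mul_le_mul_left (ENNReal.div_le_div_right h4 _) _
        _ = _ := by simp only [div_eq_mul_inv]; ring
    refine (Finset.sum_le_sum h3).trans_eq ?_
    rw [← Finset.mul_sum, ← ballWeight,
      ENNReal.div_mul_cancel (ballWeight_ne_zero j R) (ballWeight_ne_top j R)]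
  calc ∑' i, (∑ j ∈ latticeBall i R, c j) ^ q * w.weight i
      ≤ ∑' i, ∑ j ∈ latticeBall i R,
          C * b * (w.weight i / ballWeight w i R) * (c j ^ q * w.weight j) :=
        ENNReal.tsum_le_tsum h1
    _ = ∑' j, C * b * (∑ i ∈ latticeBall j R, w.weight i / ballWeight w i R)
          * (c j ^ q * w.weight j) := by
        rw [tsum_sum_latticeBall_comm]
        refine tsum_congr fun j => ?_
        rw [Finset.mul_sum, Finset.sum_mul]
    _ ≤ ∑' j, C * b * (C * ((2 ^ d : ℕ) : ℝ≥0∞) ^ q) * (c j ^ q * w.weight j) :=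
        ENNReal.tsum_le_tsum fun j => mul_le_mul_left (mul_le_mul_right (h2 j) _) _
    _ = _ := by
        rw [ENNReal.tsum_mul_left, averageConst]
        ring

end BallMean

/-! ### Layer-cake decomposition and boundedness of radial convolution. -/

section LayerCake

variable {d : ℕ} {q : ℝ} {w : PosSeq (Fin d → ℤ)} {C : ℝ≥0∞}

/-- Telescoping; the partial sums are F(r) - F(max(r, n)). Finiteness of F makes subtraction
continuous in [0, ∞]. -/
theorem Antitone.tsum_layers_eq {F : ℕ → ℝ≥0∞} (hF : Antitone F) (hfin : F 0 ≠ ∞)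
    (hlim : Filter.Tendsto F Filter.atTop (nhds 0)) (r : ℕ) :
    ∑' R, (if r ≤ R then F R - F (R + 1) else 0) = F r := by
  have hpart : ∀ n, ∑ R ∈ Finset.range n, (if r ≤ R then F R - F (R + 1) else 0)
      = F r - F (max r n) := by
    intro n
    induction n with
    | zero => simp
    | succ n ih =>
      rw [Finset.sum_range_succ, ih]
      split_ifs with h
      · rw [max_eq_right h, max_eq_right (by omega),
          tsub_add_tsub_cancel (hF h) (hF (Nat.le_succ n))]
      · rw [max_eq_left (by omega), max_eq_left (by omega), add_zero]
  have h1 := (ENNReal.summable (f := fun R =>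
    if r ≤ R then F R - F (R + 1) else 0)).hasSum.tendsto_sum_nat
  simp only [hpart] at h1
  have h2 : Filter.Tendsto (fun n => F r - F (max r n)) Filter.atTop (nhds (F r - 0)) := by
    refine ENNReal.Tendsto.sub tendsto_const_nhds ?_
      (Or.inl (ne_top_of_le_ne_top hfin (hF (Nat.zero_le r))))
    exact tendsto_of_tendsto_of_tendsto_of_le_of_le tendsto_const_nhds hlim (fun _ => zero_le)
      fun n => hF (le_max_right r n)
  rw [tsub_zero] at h2
  exact tendsto_nhds_unique h1 h2

/-- Convolution with an antitone profile is bounded on `ℓ^q_w`. -/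
theorem BallMeanBound.lqNorm_profileConv_le [NeZero d] (hC : BallMeanBound q w C) (hq : 1 ≤ q)
    {F : ℕ → ℝ≥0∞} (hF : Antitone F) (hFs : profileSum d F ≠ ∞) (c : (Fin d → ℤ) → ℝ≥0∞) :
    lqNorm q w (profileConv F c) ≤
      averageConst d q C ^ q⁻¹ * profileSum d F * lqNorm q w c := by
  have hq0 : 0 < q := by linarith
  have hlayer := hF.tsum_layers_eq (ne_top_of_le_ne_top hFs (profile_le_profileSum F 0))
    (tendsto_zero_of_profileSum_ne_top hFs)
  set δ : ℕ → ℝ≥0∞ := fun R => F R - F (R + 1) with hδ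
  set b : ℕ → ℝ≥0∞ := fun R => (((2 * R + 1) ^ d : ℕ) : ℝ≥0∞) with hb
  have hb0 : ∀ R, b R ≠ 0 := fun R => by
    simp only [hb, Ne, Nat.cast_eq_zero]
    positivity
  have hbt : ∀ R, b R ≠ ∞ := fun R => ENNReal.natCast_ne_top _
  -- The layer decomposition summed over ℤ^d: the layers, weighted by ball cardinality, have total
  -- mass `profileSum d F`.
  have hmass : ∑' R, δ R * b R = profileSum d F := by
    have : ∀ R, δ R * b R = ∑' k : Fin d → ℤ, if latticeNorm k ≤ R then δ R else 0 := by
      intro R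
      have h := profileSum_indicator (d := d) R
      change δ R * (((2 * R + 1) ^ d : ℕ) : ℝ≥0∞) = _
      rw [← h, profileSum, ← ENNReal.tsum_mul_left]
      exact tsum_congr fun k => by split_ifs <;> simp
    simp only [this]
    rw [ENNReal.tsum_comm, profileSum]
    exact tsum_congr fun k => hlayer _
  -- Convolution as a superposition of ball averages with masses δ(R) b(R); Jensen and the uniform
  -- bound for averages then apply.
  have hconv : ∀ i, profileConv F c i =
      ∑' R, δ R * b R * ((∑ j ∈ latticeBall i R, c j) / b R) := by
    intro i
    have h1 : ∀ R, δ R * b R * ((∑ j ∈ latticeBall i R, c j) / b R)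
        = ∑' j, (if latticeNorm (i - j) ≤ R then δ R else 0) * c j := by
      intro R
      rw [mul_assoc, ENNReal.mul_div_cancel (hb0 R) (hbt R), sum_latticeBall_eq_tsum,
        ← ENNReal.tsum_mul_left]
      refine tsum_congr fun j => ?_
      simp only [mem_latticeBall, latticeNorm_sub_comm j i]
      split_ifs <;> simp
    simp only [h1]
    rw [ENNReal.tsum_comm]
    refine tsum_congr fun j => ?_
    rw [ENNReal.tsum_mul_right, hlayer]
  rw [lqNorm_le_iff hq]
  set K := averageConst d q C
  set S := profileSum d F
  calc ∑' i, profileConv F c i ^ q * w.weight i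
      ≤ ∑' i, S ^ (q - 1) * (∑' R, δ R * b R * ((∑ j ∈ latticeBall i R, c j) / b R) ^ q)
          * w.weight i := by
        refine ENNReal.tsum_le_tsum fun i => mul_le_mul_left ?_ _
        rw [hconv, ← hmass]
        exact ENNReal.rpow_tsum_mul_le hq _ _
    _ = S ^ (q - 1) * ∑' R, δ R * b R * ((b R)⁻¹ ^ q *
          ∑' i, (∑ j ∈ latticeBall i R, c j) ^ q * w.weight i) := by
        simp only [mul_assoc, ENNReal.tsum_mul_left, ← ENNReal.tsum_mul_right]
        rw [ENNReal.tsum_comm]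
        simp only [← ENNReal.tsum_mul_left, div_eq_mul_inv,
          ENNReal.mul_rpow_of_nonneg _ _ hq0.le]
        refine tsum_congr fun R => tsum_congr fun i => ?_
        ring
    _ ≤ S ^ (q - 1) * ∑' R, δ R * b R * (K * lqNorm q w c ^ q) := by
        refine mul_le_mul_right (ENNReal.tsum_le_tsum fun R => mul_le_mul_right ?_ _) _
        refine (mul_le_mul_right (hC.tsum_average_le hq R c) _).trans_eq ?_
        rw [lqNorm_rpow hq, mul_comm (averageConst d q C), ← mul_assoc, ← mul_assoc,
          ← ENNReal.mul_rpow_of_nonneg _ _ hq0.le, ENNReal.inv_mul_cancel (hb0 R) (hbt R),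
          ENNReal.one_rpow, one_mul]
    _ = (K ^ q⁻¹ * S * lqNorm q w c) ^ q := by
        rw [ENNReal.tsum_mul_right, hmass, ENNReal.mul_rpow_of_nonneg _ _ hq0.le,
          ENNReal.mul_rpow_of_nonneg _ _ hq0.le, ENNReal.rpow_inv_rpow hq0.ne', ← mul_assoc]
        have : S ^ q = S ^ (q - 1) * S := by
          conv_lhs => rw [← sub_add_cancel q 1,
            ENNReal.rpow_add_of_nonneg _ _ (by linarith) zero_le_one, ENNReal.rpow_one]
        rw [this]
        ring

end LayerCake

/-! ### From ℓ^q_w to extended norms; uniqueness of operator and matrix. -/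

section WeightedLqENorm

variable {𝕜 : Type*} [RCLike 𝕜] {ι : Type*} {q : ℝ} {w : PosSeq ι}

theorem enorm_rpow_mul_weight (hq : 0 ≤ q) (w : PosSeq ι) (x : 𝕜) (i : ι) :
    ‖x‖ₑ ^ q * w.weight i = ENNReal.ofReal (‖x‖ ^ q * (w i : ℝ)) := by
  rw [ENNReal.ofReal_mul (by positivity), ← ENNReal.ofReal_rpow_of_nonneg (norm_nonneg x) hq,
    ofReal_norm, PosSeq.weight]

theorem lqNorm_single (hq : 1 ≤ q) [DecidableEq ι] (k : ι) :
    lqNorm q w (fun i => ‖(Pi.single k 1 : ι → 𝕜) i‖ₑ) = w.weight k ^ q⁻¹ := by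
  have hq0 : 0 < q := by linarith
  rw [lqNorm, tsum_eq_single k fun i hi => by simp [hi, ENNReal.zero_rpow_of_pos hq0]]
  simp

variable [Fact (1 ≤ q)]

theorem WeightedLq.enorm_eq_lqNorm (c : WeightedLq 𝕜 q w) :
    ‖c‖ₑ = lqNorm q w fun i => ‖c i‖ₑ := by
  have hq : 0 < q := lt_of_lt_of_le one_pos Fact.out
  have h0 : ∀ i, 0 ≤ ‖c i‖ ^ q * (w i : ℝ) := fun i =>
    mul_nonneg (Real.rpow_nonneg (norm_nonneg _) _) (w i).2.le
  simp only [lqNorm, enorm_rpow_mul_weight hq.le]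
  rw [← ENNReal.ofReal_tsum_of_nonneg h0 c.summable,
    ENNReal.ofReal_rpow_of_nonneg (tsum_nonneg h0) (by positivity), ← ofReal_norm,
    WeightedLq.norm_def, one_div]

/-- The element of `ℓ^q_w` given by a sequence of finite norm. -/
def WeightedLq.ofLqNorm (c : ι → 𝕜) (h : lqNorm q w (fun i => ‖c i‖ₑ) ≠ ∞) : WeightedLq 𝕜 q w :=
  ⟨c, by
    have hq : 0 < q := lt_of_lt_of_le one_pos Fact.out
    have h' : ∑' i, ‖c i‖ₑ ^ q * w.weight i ≠ ∞ := by
      rw [← lqNorm_rpow Fact.out]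
      exact ENNReal.rpow_ne_top_of_nonneg hq.le h
    have h0 : ∀ i, 0 ≤ ‖c i‖ ^ q * (w i : ℝ) := fun i =>
      mul_nonneg (Real.rpow_nonneg (norm_nonneg _) _) (w i).2.le
    simp only [enorm_rpow_mul_weight hq.le] at h'
    have hs := ENNReal.summable_toReal h'
    simp only [ENNReal.toReal_ofReal (h0 _)] at hs
    exact hs⟩

theorem WeightedLq.ofLqNorm_apply (c : ι → 𝕜) (h : lqNorm q w (fun i => ‖c i‖ₑ) ≠ ∞) (i : ι) :
    WeightedLq.ofLqNorm c h i = c i := rfl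

/-- The unit sequence at `k`. -/
noncomputable def WeightedLq.single [DecidableEq ι] (k : ι) : WeightedLq 𝕜 q w :=
  WeightedLq.ofLqNorm (Pi.single k 1) (by
    have hq : (1 : ℝ) ≤ q := Fact.out
    rw [lqNorm_single hq]
    exact ENNReal.rpow_ne_top_of_nonneg (inv_nonneg.2 (by linarith)) (w.weight_ne_top k))

theorem WeightedLq.single_apply [DecidableEq ι] (k i : ι) :
    (WeightedLq.single k : WeightedLq 𝕜 q w) i = if i = k then 1 else 0 := by
  change (Pi.single k 1 : ι → 𝕜) i = _
  rw [Pi.single_apply]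

theorem summable_of_tsum_enorm_ne_top {κ : Type*} {f : κ → 𝕜} (h : ∑' i, ‖f i‖ₑ ≠ ∞) :
    Summable f :=
  Summable.of_nnnorm (ENNReal.tsum_coe_ne_top_iff_summable.1 h)

theorem IsOperatorOf.unique {A : Matrix ι ι 𝕜}
    {T U : WeightedLq 𝕜 q w →L[𝕜] WeightedLq 𝕜 q w} (hT : IsOperatorOf A T)
    (hU : IsOperatorOf A U) : T = U :=
  ContinuousLinearMap.ext fun c => WeightedLq.ext fun i => (hT c i).unique (hU c i)

theorem IsOperatorOf.apply_single [DecidableEq ι] {A : Matrix ι ι 𝕜}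
    {T : WeightedLq 𝕜 q w →L[𝕜] WeightedLq 𝕜 q w} (hT : IsOperatorOf A T) (i k : ι) :
    T (WeightedLq.single k) i = A i k := by
  refine (hT (WeightedLq.single k) i).unique ?_
  convert hasSum_single k fun j hj => ?_ using 1
  · rw [WeightedLq.single_apply, if_pos rfl, mul_one]
  · rw [WeightedLq.single_apply, if_neg hj, mul_zero]

theorem IsOperatorOf.matrix_unique {A B : Matrix ι ι 𝕜}
    {T : WeightedLq 𝕜 q w →L[𝕜] WeightedLq 𝕜 q w} (hA : IsOperatorOf A T)
    (hB : IsOperatorOf B T) : A = B := by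
  classical
  ext i k
  rw [← hA.apply_single, ← hB.apply_single]

end WeightedLqENorm

/-! ### The Beurling class as an algebra of bounded operators. -/

section BeurlingOperators

variable {𝕜 : Type*} [RCLike 𝕜] {d : ℕ} {A B : Matrix (Fin d → ℤ) (Fin d → ℤ) 𝕜}
  {F G : ℕ → ℝ≥0∞}

/-- The entries of `A` are dominated by the radial function with profile `F`. -/
def HasProfile (A : Matrix (Fin d → ℤ) (Fin d → ℤ) 𝕜) (F : ℕ → ℝ≥0∞) : Prop :=
  ∀ i j, ‖A i j‖ₑ ≤ F (latticeNorm (i - j))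

/-- The least antitone profile of A is r ↦ sup of |a(i,j)| over |i-j| ≥ r, and its sum over ℤ^d is
the norm of A. -/
theorem mem_beurlingClass_iff :
    A ∈ beurlingClass 𝕜 d ↔ ∃ F, Antitone F ∧ profileSum d F ≠ ∞ ∧ HasProfile A F := by
  have hnorm : ∀ k i j : Fin d → ℤ, ‖k‖ ≤ ‖i - j‖ ↔ latticeNorm k ≤ latticeNorm (i - j) :=
    fun k i j => by rw [norm_eq_latticeNorm, norm_eq_latticeNorm, Nat.cast_le]
  simp only [beurlingClass, beurlingNorm, Set.mem_ofPred_eq, hnorm]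
  constructor
  · intro h
    refine ⟨fun r => ⨆ (i) (j) (_ : r ≤ latticeNorm (i - j)), ‖A i j‖ₑ, fun r s hrs => ?_, h.ne,
      fun i j => ?_⟩
    · exact iSup_mono fun i => iSup_mono fun j => iSup_mono' fun hs => ⟨hrs.trans hs, le_rfl⟩
    · exact le_iSup_of_le i (le_iSup_of_le j (le_iSup_of_le le_rfl le_rfl))
  · rintro ⟨F, hF, hFs, hA⟩
    refine lt_of_le_of_lt (ENNReal.tsum_le_tsum fun k => ?_) hFs.lt_top
    exact iSup_le fun i => iSup_le fun j => iSup_le fun h => (hA i j).trans (hF h)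

theorem HasProfile.tsum_enorm_mul_le (hA : HasProfile A F) (c : (Fin d → ℤ) → 𝕜)
    (i : Fin d → ℤ) : ∑' j, ‖A i j * c j‖ₑ ≤ profileConv F (fun j => ‖c j‖ₑ) i :=
  ENNReal.tsum_le_tsum fun j => by
    rw [enorm_mul]
    exact mul_le_mul_left (hA i j) _

theorem HasProfile.tsum_enorm_mul_entries_le (hA : HasProfile A F) (hB : HasProfile B G)
    (hF : Antitone F) (hG : Antitone G) (i k : Fin d → ℤ) :
    ∑' j, ‖A i j * B j k‖ₑ ≤ profileMul d F G (latticeNorm (i - k)) := by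
  refine le_trans (ENNReal.tsum_le_tsum fun j => ?_) (profileConv_profile_le hF hG i k)
  rw [enorm_mul]
  exact mul_le_mul' (hA i j) (hB j k)

theorem HasProfile.infMatrixMul (hA : HasProfile A F) (hB : HasProfile B G)
    (hF : Antitone F) (hG : Antitone G) : HasProfile (infMatrixMul A B) (profileMul d F G) :=
  fun i k => (enorm_tsum_le_tsum_enorm).trans (hA.tsum_enorm_mul_entries_le hB hF hG i k)

theorem profileSum_profileMul_ne_top (hFs : profileSum d F ≠ ∞) (hGs : profileSum d G ≠ ∞) :
    profileSum d (profileMul d F G) ≠ ∞ :=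
  ne_top_of_le_ne_top (ENNReal.mul_ne_top
    (ENNReal.mul_ne_top ENNReal.ofNat_ne_top (ENNReal.natCast_ne_top _))
    (ENNReal.mul_ne_top hFs hGs)) (profileSum_profileMul_le F G)

theorem infMatrixMul_mem_beurlingClass (hA : A ∈ beurlingClass 𝕜 d) (hB : B ∈ beurlingClass 𝕜 d) :
    infMatrixMul A B ∈ beurlingClass 𝕜 d := by
  obtain ⟨F, hF, hFs, hAF⟩ := mem_beurlingClass_iff.1 hA
  obtain ⟨G, hG, hGs, hBG⟩ := mem_beurlingClass_iff.1 hB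
  exact mem_beurlingClass_iff.2 ⟨profileMul d F G, profileMul_antitone hF hG,
    profileSum_profileMul_ne_top hFs hGs, hAF.infMatrixMul hBG hF hG⟩

theorem summable_mul_of_mem_beurlingClass [NeZero d] (hA : A ∈ beurlingClass 𝕜 d)
    (hB : B ∈ beurlingClass 𝕜 d) (i k : Fin d → ℤ) : Summable fun j => A i j * B j k := by
  obtain ⟨F, hF, hFs, hAF⟩ := mem_beurlingClass_iff.1 hA
  obtain ⟨G, hG, hGs, hBG⟩ := mem_beurlingClass_iff.1 hB
  exact summable_of_tsum_enorm_ne_top (ne_top_of_le_ne_top (ne_top_of_le_ne_top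
    (profileSum_profileMul_ne_top hFs hGs) (profile_le_profileSum (d := d) _ _))
    (hAF.tsum_enorm_mul_entries_le hBG hF hG i k))

theorem add_mem_beurlingClass (hA : A ∈ beurlingClass 𝕜 d) (hB : B ∈ beurlingClass 𝕜 d) :
    A + B ∈ beurlingClass 𝕜 d := by
  obtain ⟨F, hF, hFs, hAF⟩ := mem_beurlingClass_iff.1 hA
  obtain ⟨G, hG, hGs, hBG⟩ := mem_beurlingClass_iff.1 hB
  refine mem_beurlingClass_iff.2 ⟨fun r => F r + G r, hF.add hG, ?_, fun i j => ?_⟩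
  · rw [profileSum_add]
    exact ENNReal.add_ne_top.2 ⟨hFs, hGs⟩
  · exact (enorm_add_le _ _).trans (add_le_add (hAF i j) (hBG i j))

theorem diagonal_mem_beurlingClass (r : 𝕜) :
    Matrix.diagonal (fun _ => r) ∈ beurlingClass 𝕜 d := by
  refine mem_beurlingClass_iff.2 ⟨fun n => ‖r‖ₑ * if n ≤ 0 then 1 else 0, fun m n h => ?_, ?_,
    fun i j => ?_⟩
  · refine mul_le_mul_right ?_ _
    split_ifs <;> first | omega | simp
  · rw [profileSum_const_mul, profileSum_indicator]
    exact ENNReal.mul_ne_top enorm_ne_top (ENNReal.natCast_ne_top _)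
  · by_cases h : i = j
    · subst h
      simp [latticeNorm_zero]
    · simp [Matrix.diagonal_apply_ne _ h]

variable {q : ℝ} [Fact (1 ≤ q)] {w : PosSeq (Fin d → ℤ)} {C : ℝ≥0∞}
  {T U : WeightedLq 𝕜 q w →L[𝕜] WeightedLq 𝕜 q w}

theorem isOperatorOf_diagonal (r : 𝕜) :
    IsOperatorOf (Matrix.diagonal fun _ => r)
      (algebraMap 𝕜 (WeightedLq 𝕜 q w →L[𝕜] WeightedLq 𝕜 q w) r) := by
  intro c i
  convert hasSum_single i fun j hj => ?_ using 1
  · rw [Matrix.diagonal_apply_eq]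
    rfl
  · rw [Matrix.diagonal_apply_ne _ hj.symm, zero_mul]

theorem IsOperatorOf.add (hT : IsOperatorOf A T) (hU : IsOperatorOf B U) :
    IsOperatorOf (A + B) (T + U) := fun c i => by
  simp only [Matrix.add_apply, add_mul]
  exact (hT c i).add (hU c i)

theorem WeightedLq.lqNorm_ne_top (c : WeightedLq 𝕜 q w) : lqNorm q w (fun i => ‖c i‖ₑ) ≠ ∞ := by
  rw [← c.enorm_eq_lqNorm]
  exact enorm_ne_top

theorem BallMeanBound.lqNorm_profileConv_ne_top [NeZero d] (hC : BallMeanBound q w C)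
    (hCt : C ≠ ∞) (hF : Antitone F) (hFs : profileSum d F ≠ ∞) {c : (Fin d → ℤ) → ℝ≥0∞}
    (hc : lqNorm q w c ≠ ∞) : lqNorm q w (profileConv F c) ≠ ∞ := by
  have hq : (1 : ℝ) ≤ q := Fact.out
  exact ne_top_of_le_ne_top (ENNReal.mul_ne_top (ENNReal.mul_ne_top
    (ENNReal.rpow_ne_top_of_nonneg (inv_nonneg.2 (by linarith)) (averageConst_ne_top hq hCt)) hFs)
    hc) (hC.lqNorm_profileConv_le hq hF hFs c)

theorem HasProfile.exists_isOperatorOf [NeZero d] (hA : HasProfile A F) (hF : Antitone F)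
    (hFs : profileSum d F ≠ ∞) (hC : BallMeanBound q w C) (hCt : C ≠ ∞) :
    ∃ T : WeightedLq 𝕜 q w →L[𝕜] WeightedLq 𝕜 q w, IsOperatorOf A T := by
  have hq : (1 : ℝ) ≤ q := Fact.out
  have hfin : ∀ c : WeightedLq 𝕜 q w, lqNorm q w (profileConv F fun j => ‖c j‖ₑ) ≠ ∞ := fun c =>
    hC.lqNorm_profileConv_ne_top hCt hF hFs c.lqNorm_ne_top
  have hsum : ∀ (c : WeightedLq 𝕜 q w) i, Summable fun j => A i j * c j := fun c i =>
    summable_of_tsum_enorm_ne_top (ne_top_of_le_ne_top (ne_top_of_lqNorm_ne_top hq (hfin c) i)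
      (hA.tsum_enorm_mul_le c i))
  have hle : ∀ (c : WeightedLq 𝕜 q w),
      lqNorm q w (fun i => ‖∑' j, A i j * c j‖ₑ) ≤ lqNorm q w (profileConv F fun j => ‖c j‖ₑ) :=
    fun c => lqNorm_mono hq fun i =>
      enorm_tsum_le_tsum_enorm.trans (hA.tsum_enorm_mul_le c i)
  let T₀ : WeightedLq 𝕜 q w →ₗ[𝕜] WeightedLq 𝕜 q w :=
    { toFun := fun c => WeightedLq.ofLqNorm (fun i => ∑' j, A i j * c j)
        (ne_top_of_le_ne_top (hfin c) (hle c))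
      map_add' := fun c c' => WeightedLq.ext fun i => by
        rw [WeightedLq.add_apply]
        simp only [WeightedLq.ofLqNorm_apply, WeightedLq.add_apply, mul_add]
        exact (hsum c i).tsum_add (hsum c' i)
      map_smul' := fun r c => WeightedLq.ext fun i => by
        rw [RingHom.id_apply, WeightedLq.smul_apply]
        simp only [WeightedLq.ofLqNorm_apply, WeightedLq.smul_apply, mul_left_comm _ r]
        exact tsum_mul_left }
  set M : ℝ≥0∞ := averageConst d q C ^ q⁻¹ * profileSum d F with hM
  have hMt : M ≠ ∞ := ENNReal.mul_ne_top
    (ENNReal.rpow_ne_top_of_nonneg (inv_nonneg.2 (by linarith)) (averageConst_ne_top hq hCt)) hFs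
  refine ⟨T₀.mkContinuous M.toReal fun c => ?_, fun c i => (hsum c i).hasSum⟩
  have h : ‖T₀ c‖ₑ ≤ M * ‖c‖ₑ := by
    rw [WeightedLq.enorm_eq_lqNorm, WeightedLq.enorm_eq_lqNorm]
    exact (hle c).trans (hC.lqNorm_profileConv_le hq hF hFs _)
  have h' := ENNReal.toReal_mono (ENNReal.mul_ne_top hMt enorm_ne_top) h
  rwa [ENNReal.toReal_mul, toReal_enorm, toReal_enorm] at h'

/-- Fubini: the double series defining T(Uc)(i) is dominated by (F * (G * |c|))(i), finite because
both convolutions preserve ℓ^q_w. -/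
theorem HasProfile.isOperatorOf_mul [NeZero d] (hA : HasProfile A F) (hF : Antitone F)
    (hFs : profileSum d F ≠ ∞) (hB : HasProfile B G) (hG : Antitone G)
    (hGs : profileSum d G ≠ ∞) (hC : BallMeanBound q w C) (hCt : C ≠ ∞)
    (hT : IsOperatorOf A T) (hU : IsOperatorOf B U) :
    IsOperatorOf (_root_.infMatrixMul A B) (T * U) := by
  have hq : (1 : ℝ) ≤ q := Fact.out
  intro c i
  have hfin : profileConv F (profileConv G fun j => ‖c j‖ₑ) i ≠ ∞ :=
    ne_top_of_lqNorm_ne_top hq (hC.lqNorm_profileConv_ne_top hCt hF hFs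
      (hC.lqNorm_profileConv_ne_top hCt hG hGs c.lqNorm_ne_top)) i
  have hprod : Summable fun p : (Fin d → ℤ) × (Fin d → ℤ) => A i p.1 * (B p.1 p.2 * c p.2) := by
    refine summable_of_tsum_enorm_ne_top (ne_top_of_le_ne_top hfin ?_)
    rw [ENNReal.tsum_prod']
    refine ENNReal.tsum_le_tsum fun j => ?_
    simp only [enorm_mul, ENNReal.tsum_mul_left]
    refine mul_le_mul' (hA i j) (le_of_eq_of_le ?_ (hB.tsum_enorm_mul_le c j))
    simp only [enorm_mul]
  have h1 : HasSum (fun j => A i j * U c j) (∑' p : (Fin d → ℤ) × (Fin d → ℤ),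
      A i p.1 * (B p.1 p.2 * c p.2)) :=
    hprod.hasSum.prod_fiberwise fun j => (hU c j).mul_left (A i j)
  have h2 := (Equiv.prodComm (Fin d → ℤ) (Fin d → ℤ)).hasSum_iff.2 hprod.hasSum
  have h3 : (T * U) c i = ∑' p : (Fin d → ℤ) × (Fin d → ℤ), A i p.1 * (B p.1 p.2 * c p.2) :=
    (hT (U c) i).unique h1
  rw [h3]
  refine h2.prod_fiberwise fun k => ?_
  have hs := summable_mul_of_mem_beurlingClass
    (mem_beurlingClass_iff.2 ⟨F, hF, hFs, hA⟩) (mem_beurlingClass_iff.2 ⟨G, hG, hGs, hB⟩) i k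
  have := hs.hasSum.mul_right (c k)
  simp only [mul_assoc] at this
  exact this

end BeurlingOperators

/-! ### Local weighted means at scale N. -/

section LocalMean

variable {d : ℕ} {q : ℝ} {w : PosSeq (Fin d → ℤ)} {C : ℝ≥0∞}

/-- The restriction of a sequence to a ball. -/
noncomputable def ballPart (n : Fin d → ℤ) (R : ℕ) (c : (Fin d → ℤ) → ℝ≥0∞) (j : Fin d → ℤ) :
    ℝ≥0∞ :=
  if j ∈ latticeBall n R then c j else 0

/-- The `q`-mean of a sequence on the ball `B(n, N)` with respect to the weight. -/
noncomputable def localMean (q : ℝ) (w : PosSeq (Fin d → ℤ)) (N : ℕ) (c : (Fin d → ℤ) → ℝ≥0∞)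
    (n : Fin d → ℤ) : ℝ≥0∞ :=
  lqNorm q w (ballPart n N c) / ballWeight w n N ^ q⁻¹

theorem ballWeight_rpow_ne_zero (hq : 1 ≤ q) (n : Fin d → ℤ) (R : ℕ) :
    ballWeight w n R ^ q⁻¹ ≠ 0 := by
  have : 0 < q := by linarith
  simp [ENNReal.rpow_eq_zero_iff, ballWeight_ne_zero, ballWeight_ne_top]

theorem ballWeight_rpow_ne_top (hq : 1 ≤ q) (n : Fin d → ℤ) (R : ℕ) :
    ballWeight w n R ^ q⁻¹ ≠ ∞ :=
  ENNReal.rpow_ne_top_of_nonneg (inv_nonneg.2 (by linarith)) (ballWeight_ne_top n R)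

theorem localMean_mul (hq : 1 ≤ q) (N : ℕ) (c : (Fin d → ℤ) → ℝ≥0∞) (n : Fin d → ℤ) :
    localMean q w N c n * ballWeight w n N ^ q⁻¹ = lqNorm q w (ballPart n N c) :=
  ENNReal.div_mul_cancel (ballWeight_rpow_ne_zero hq n N) (ballWeight_rpow_ne_top hq n N)

theorem sum_latticeBall_rpow_mul_weight (hq : 1 ≤ q) (c : (Fin d → ℤ) → ℝ≥0∞) (n : Fin d → ℤ)
    (R : ℕ) : ∑ j ∈ latticeBall n R, c j ^ q * w.weight j = lqNorm q w (ballPart n R c) ^ q := by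
  rw [lqNorm_rpow hq, sum_latticeBall_eq_tsum]
  refine tsum_congr fun j => ?_
  rw [ballPart]
  split_ifs
  · rfl
  · rw [ENNReal.zero_rpow_of_pos (by linarith), zero_mul]

theorem lqNorm_ballPart_one (hq : 1 ≤ q) (n : Fin d → ℤ) (R : ℕ) :
    lqNorm q w (ballPart n R fun _ => 1) = ballWeight w n R ^ q⁻¹ := by
  have h := sum_latticeBall_rpow_mul_weight (w := w) hq (fun _ => 1) n R
  simp only [ENNReal.one_rpow, one_mul] at h
  rw [ballWeight, h, ENNReal.rpow_rpow_inv (by linarith)]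

/-- The constant in the doubling inequality for `w(B)^{1/q}`. -/
noncomputable def doublingConst (d : ℕ) (q : ℝ) (C : ℝ≥0∞) (t : ℕ) : ℝ≥0∞ :=
  (C * ((t ^ d : ℕ) : ℝ≥0∞) ^ q) ^ q⁻¹

theorem doublingConst_ne_top (hq : 1 ≤ q) (hC : C ≠ ∞) (t : ℕ) : doublingConst d q C t ≠ ∞ :=
  ENNReal.rpow_ne_top_of_nonneg (inv_nonneg.2 (by linarith)) (ENNReal.mul_ne_top hC
    (ENNReal.rpow_ne_top_of_nonneg (by linarith) (ENNReal.natCast_ne_top _)))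

theorem BallMeanBound.ballWeight_rpow_le (hC : BallMeanBound q w C) (hq : 1 ≤ q)
    {n m : Fin d → ℤ} {R R' t : ℕ} (ht : 2 * R' + 1 ≤ t * (2 * R + 1))
    (h : latticeBall n R ⊆ latticeBall m R') :
    ballWeight w m R' ^ q⁻¹ ≤ doublingConst d q C t * ballWeight w n R ^ q⁻¹ := by
  have hq' : 0 ≤ q⁻¹ := inv_nonneg.2 (by linarith)
  rw [doublingConst, ← ENNReal.mul_rpow_of_nonneg _ _ hq']
  exact ENNReal.rpow_le_rpow (hC.ballWeight_le hq ht h) hq'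

/-- One doubling constant for all balls met below: B(m,N) with m in B(n,6N), and B(n,2N), all inside
B(n,7N). The ratio is 7 since 2·7N+1 ≤ 7(2N+1). -/
theorem BallMeanBound.ballWeight_rpow_le_seven (hC : BallMeanBound q w C) (hq : 1 ≤ q)
    {n m : Fin d → ℤ} {R N : ℕ} (h : latticeNorm (m - n) + R ≤ 7 * N) :
    ballWeight w m R ^ q⁻¹ ≤ doublingConst d q C 7 * ballWeight w n N ^ q⁻¹ := by
  refine (ENNReal.rpow_le_rpow (ballWeight_mono (latticeBall_subset h))
    (inv_nonneg.2 (by linarith))).trans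
    (hC.ballWeight_rpow_le hq (by omega) (latticeBall_subset ?_))
  rw [sub_self, latticeNorm_zero]
  omega

/-- The q-th root of the mean bound: an unweighted sum is controlled by a weighted mean, so the
weight can disappear from the far terms. -/
theorem BallMeanBound.sum_latticeBall_le (hC : BallMeanBound q w C) (hq : 1 ≤ q)
    (c : (Fin d → ℤ) → ℝ≥0∞) (m : Fin d → ℤ) (N : ℕ) :
    ∑ j ∈ latticeBall m N, c j ≤
      C ^ q⁻¹ * (((2 * N + 1) ^ d : ℕ) : ℝ≥0∞) * localMean q w N c m := by
  have hq0 : 0 < q := by linarith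
  have hq' : 0 ≤ q⁻¹ := inv_nonneg.2 hq0.le
  have h := ENNReal.rpow_le_rpow (hC m N c) hq'
  rw [sum_latticeBall_rpow_mul_weight hq, ← ballWeight,
    ENNReal.mul_rpow_of_nonneg _ _ hq', ENNReal.mul_rpow_of_nonneg _ _ hq',
    ENNReal.mul_rpow_of_nonneg _ _ hq', ENNReal.rpow_rpow_inv hq0.ne',
    ENNReal.rpow_rpow_inv hq0.ne', ENNReal.rpow_rpow_inv hq0.ne'] at h
  rw [localMean, ← mul_div_assoc]
  exact (ENNReal.le_div_iff_mul_le (Or.inl (ballWeight_rpow_ne_zero hq m N))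
    (Or.inl (ballWeight_rpow_ne_top hq m N))).2 h

/-- The contribution of points far away from `n`, in terms of local means. -/
theorem BallMeanBound.tsum_far_le (hC : BallMeanBound q w C) (hq : 1 ≤ q)
    {H : ℕ → ℝ≥0∞} (hH : Antitone H) (c : (Fin d → ℤ) → ℝ≥0∞) (n : Fin d → ℤ) (N : ℕ) :
    ∑' j, (if j ∈ latticeBall n (5 * N) then 0 else H (latticeNorm (j - n) - 2 * N) * c j) ≤
      C ^ q⁻¹ * profileConv (fun r => H (max (r - 3 * N) N)) (localMean q w N c) n := by
  set φ : (Fin d → ℤ) → ℝ≥0∞ := fun j =>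
    if j ∈ latticeBall n (5 * N) then 0 else H (latticeNorm (j - n) - 2 * N) * c j with hφ
  set b : ℝ≥0∞ := (((2 * N + 1) ^ d : ℕ) : ℝ≥0∞) with hb
  have hb0 : b ≠ 0 := by
    rw [hb, Ne, Nat.cast_eq_zero]
    positivity
  rw [← ENNReal.mul_le_mul_iff_right hb0 (ENNReal.natCast_ne_top _)]
  -- Each j is spread over the b centres m whose ball B(m,N) contains it.
  calc b * ∑' j, φ j = ∑' j, ∑ m ∈ latticeBall j N, φ j := by
        simp only [Finset.sum_const, card_latticeBall, nsmul_eq_mul]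
        rw [← ENNReal.tsum_mul_left]
    _ = ∑' m, ∑ j ∈ latticeBall m N, φ j := tsum_sum_latticeBall_comm N fun j _ => φ j
    _ ≤ ∑' m, H (max (latticeNorm (n - m) - 3 * N) N) * (C ^ q⁻¹ * b * localMean q w N c m) := by
        refine ENNReal.tsum_le_tsum fun m =>
          le_trans ?_ (mul_le_mul_right (hC.sum_latticeBall_le hq c m N) _)
        rw [Finset.mul_sum]
        refine Finset.sum_le_sum fun j hj => ?_
        simp only [hφ]
        split_ifs with h
        · exact zero_le
        -- Here |j-m| ≤ N and |j-n| > 5N, so |j-n| - 2N is at least both |n-m| - 3N and N.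
        · refine mul_le_mul_left (hH ?_) _
          rw [mem_latticeBall] at h hj
          have h1 := latticeNorm_sub_le n j m
          rw [latticeNorm_sub_comm n j] at h1
          omega
    _ = b * (C ^ q⁻¹ * profileConv (fun r => H (max (r - 3 * N) N)) (localMean q w N c) n) := by
        rw [profileConv, ← ENNReal.tsum_mul_left, ← ENNReal.tsum_mul_left]
        exact tsum_congr fun m => by ring

/-- Each point of B(n,5N) belongs to all (2N+1)^d balls of radius N centred within N of it, and
those centres lie in B(n,6N). -/
theorem mul_ballPart_le_sum (c : (Fin d → ℤ) → ℝ≥0∞) (n : Fin d → ℤ) (N : ℕ) (j : Fin d → ℤ) :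
    (((2 * N + 1) ^ d : ℕ) : ℝ≥0∞) * ballPart n (5 * N) c j ≤
      ∑ m ∈ latticeBall n (6 * N), ballPart m N c j := by
  by_cases h : j ∈ latticeBall n (5 * N)
  · have hsub : latticeBall j N ⊆ latticeBall n (6 * N) := by
      refine latticeBall_subset ?_
      rw [mem_latticeBall] at h
      omega
    refine le_trans (le_of_eq ?_) (Finset.sum_le_sum_of_subset hsub)
    rw [Finset.sum_congr rfl fun m hm => by
      rw [ballPart, if_pos (mem_latticeBall_comm.1 hm)], Finset.sum_const, card_latticeBall,
      nsmul_eq_mul, ballPart, if_pos h]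
  · simp [ballPart, h]

/-- The contribution of points near `n`, in terms of local means. -/
theorem BallMeanBound.lqNorm_near_le (hC : BallMeanBound q w C) (hq : 1 ≤ q)
    (c : (Fin d → ℤ) → ℝ≥0∞) (n : Fin d → ℤ) (N : ℕ) :
    lqNorm q w (ballPart n (5 * N) c) ≤ doublingConst d q C 7 * ballWeight w n N ^ q⁻¹ *
      profileConv (fun r => (((2 * N + 1) ^ d : ℕ) : ℝ≥0∞)⁻¹ * if r ≤ 6 * N then 1 else 0)
        (localMean q w N c) n := by
  set b : ℝ≥0∞ := (((2 * N + 1) ^ d : ℕ) : ℝ≥0∞) with hb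
  have hb0 : b ≠ 0 := by
    rw [hb, Ne, Nat.cast_eq_zero]
    positivity
  have hbt : b ≠ ∞ := ENNReal.natCast_ne_top _
  rw [← ENNReal.mul_le_mul_iff_right hb0 hbt, ← lqNorm_const_mul hq]
  calc lqNorm q w (fun j => b * ballPart n (5 * N) c j)
      ≤ lqNorm q w (fun j => ∑ m ∈ latticeBall n (6 * N), ballPart m N c j) :=
        lqNorm_mono hq (mul_ballPart_le_sum c n N)
    _ ≤ ∑ m ∈ latticeBall n (6 * N), lqNorm q w (ballPart m N c) := lqNorm_sum_le hq _ _
    _ ≤ ∑ m ∈ latticeBall n (6 * N),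
          doublingConst d q C 7 * ballWeight w n N ^ q⁻¹ * localMean q w N c m := by
        refine Finset.sum_le_sum fun m hm => ?_
        rw [← localMean_mul hq, mul_comm]
        refine mul_le_mul_left (hC.ballWeight_rpow_le_seven hq ?_) _
        rw [mem_latticeBall] at hm
        omega
    _ = b * (doublingConst d q C 7 * ballWeight w n N ^ q⁻¹ *
          profileConv (fun r => b⁻¹ * if r ≤ 6 * N then 1 else 0) (localMean q w N c) n) := by
        rw [← Finset.mul_sum, sum_latticeBall_eq_tsum, mul_left_comm, profileConv,
          ← ENNReal.tsum_mul_left (a := b)]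
        congr 1
        refine tsum_congr fun m => ?_
        simp only [mem_latticeBall, latticeNorm_sub_comm m n]
        rw [← mul_assoc, ← mul_assoc, ENNReal.mul_inv_cancel hb0 hbt, one_mul]
        split_ifs <;> simp

/-- From w(n) ≤ w(B(n,N)) and double counting. The bound grows with N, which is harmless: only
finiteness is needed to make the remainder of the iteration vanish. -/
theorem lqNorm_localMean_ne_top (hq : 1 ≤ q) {c : (Fin d → ℤ) → ℝ≥0∞}
    (hc : lqNorm q w c ≠ ∞) (N : ℕ) : lqNorm q w (localMean q w N c) ≠ ∞ := by
  have hq0 : 0 < q := by linarith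
  set b : ℝ≥0∞ := (((2 * N + 1) ^ d : ℕ) : ℝ≥0∞) with hb
  have h : lqNorm q w (localMean q w N c) ^ q ≤ b * lqNorm q w c ^ q := by
    calc lqNorm q w (localMean q w N c) ^ q
        = ∑' n, localMean q w N c n ^ q * w.weight n := lqNorm_rpow hq _
      _ ≤ ∑' n, ∑ j ∈ latticeBall n N, c j ^ q * w.weight j := by
          refine ENNReal.tsum_le_tsum fun n => ?_
          rw [sum_latticeBall_rpow_mul_weight hq, ← localMean_mul hq,
            ENNReal.mul_rpow_of_nonneg _ _ hq0.le, ENNReal.rpow_inv_rpow hq0.ne']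
          exact mul_le_mul_right (weight_le_ballWeight (self_mem_latticeBall n N)) _
      _ = b * lqNorm q w c ^ q := by
          rw [tsum_sum_latticeBall_comm N fun _ j => c j ^ q * w.weight j, lqNorm_rpow hq]
          simp only [Finset.sum_const, card_latticeBall, nsmul_eq_mul]
          rw [← ENNReal.tsum_mul_left]
  intro htop
  rw [htop, ENNReal.top_rpow_of_pos hq0] at h
  exact ENNReal.mul_ne_top (ENNReal.natCast_ne_top _)
    (ENNReal.rpow_ne_top_of_nonneg hq0.le hc) (top_le_iff.1 h)

/-- A point is a ball of radius 0, so doubling with ratio 2N+1 compares w(i) with w(B(i,N)). -/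
theorem BallMeanBound.le_localMean (hC : BallMeanBound q w C) (hq : 1 ≤ q)
    (c : (Fin d → ℤ) → ℝ≥0∞) (i : Fin d → ℤ) (N : ℕ) :
    c i ≤ doublingConst d q C (2 * N + 1) * localMean q w N c i := by
  have h1 := le_lqNorm (w := w) hq (ballPart i N c) i
  have h0 : ballWeight w i 0 = w.weight i := by
    rw [ballWeight, Finset.sum_eq_single i (fun j hj hji => ?_)
      (fun h => absurd (self_mem_latticeBall i 0) h)]
    rw [mem_latticeBall, Nat.le_zero] at hj
    exact absurd (sub_eq_zero.1 (latticeNorm_eq_zero hj)) hji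
  have h2 : ballWeight w i N ^ q⁻¹ ≤ doublingConst d q C (2 * N + 1) * w.weight i ^ q⁻¹ := by
    rw [← h0]
    refine hC.ballWeight_rpow_le hq (by simp) (latticeBall_subset ?_)
    rw [sub_self, latticeNorm_zero]
    omega
  rw [← localMean_mul hq, ballPart, if_pos (self_mem_latticeBall i N)] at h1
  have hwt : w.weight i ^ q⁻¹ ≠ ∞ :=
    ENNReal.rpow_ne_top_of_nonneg (inv_nonneg.2 (by linarith)) (w.weight_ne_top i)
  rw [← ENNReal.mul_le_mul_iff_left (w.weight_rpow_ne_zero hq i) hwt]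
  refine h1.trans ((mul_le_mul_right h2 _).trans_eq ?_)
  ring

end LocalMean

/-! ### Lipschitz cutoff functions. -/

section Cutoff

/-- The piecewise linear function that is `1` on `[0, N]` and `0` on `[2N, ∞)`. -/
noncomputable def cutoff (N r : ℕ) : ℝ :=
  max 0 (min 1 (2 - (r : ℝ) / N))

theorem cutoff_nonneg (N r : ℕ) : 0 ≤ cutoff N r := le_max_left _ _

theorem cutoff_le_one (N r : ℕ) : cutoff N r ≤ 1 := max_le zero_le_one (min_le_left _ _)

theorem cutoff_eq_one {N r : ℕ} (h : r ≤ N) : cutoff N r = 1 := by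
  have h1 : (r : ℝ) / N ≤ 1 := div_le_one_of_le₀ (Nat.cast_le.2 h) (Nat.cast_nonneg N)
  rw [cutoff, min_eq_left (by linarith), max_eq_right zero_le_one]

/-- `N ≠ 0` is essential: division by zero gives zero, so `cutoff 0` is identically 1. -/
theorem cutoff_eq_zero {N r : ℕ} (hN : N ≠ 0) (h : 2 * N ≤ r) : cutoff N r = 0 := by
  have hN' : (0 : ℝ) < N := Nat.cast_pos.2 (Nat.pos_of_ne_zero hN)
  have h1 : (2 : ℝ) ≤ (r : ℝ) / N := by
    rw [le_div_iff₀ hN']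
    exact_mod_cast h
  rw [cutoff, max_eq_left (min_le_of_right_le (by linarith))]

theorem abs_cutoff_sub_le_one (N r s : ℕ) : |cutoff N r - cutoff N s| ≤ 1 :=
  abs_sub_le_iff.2 ⟨by linarith [cutoff_nonneg N s, cutoff_le_one N r],
    by linarith [cutoff_nonneg N r, cutoff_le_one N s]⟩

theorem abs_cutoff_sub_le {N r s t : ℕ} (h1 : r ≤ s + t) (h2 : s ≤ r + t) :
    |cutoff N r - cutoff N s| ≤ (t : ℝ) / N := by
  have h : |cutoff N r - cutoff N s| ≤ |(2 - (r : ℝ) / N) - (2 - (s : ℝ) / N)| := by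
    refine (abs_max_sub_max_le_max _ _ _ _).trans ?_
    rw [sub_self, abs_zero, max_eq_right (abs_nonneg _)]
    refine (abs_min_sub_min_le_max _ _ _ _).trans ?_
    rw [sub_self, abs_zero, max_eq_right (abs_nonneg _)]
  refine h.trans ?_
  rw [show (2 - (r : ℝ) / N) - (2 - (s : ℝ) / N) = ((s : ℝ) - r) / N by ring, abs_div,
    Nat.abs_cast]
  refine div_le_div_of_nonneg_right ?_ (Nat.cast_nonneg N)
  have h1' : (r : ℝ) ≤ s + t := by exact_mod_cast h1
  have h2' : (s : ℝ) ≤ r + t := by exact_mod_cast h2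
  exact abs_sub_le_iff.2 ⟨by linarith, by linarith⟩

end Cutoff

/-! ### Smallness of the coupling profile. -/

section Coupling

variable {d : ℕ} {q : ℝ} {C M : ℝ≥0∞} {H : ℕ → ℝ≥0∞}

/-- The profile of the coupling of the local means of `c` in the localized stability
inequality. -/
noncomputable def couplingProfile (d : ℕ) (q : ℝ) (C M g : ℝ≥0∞) (H : ℕ → ℝ≥0∞) (N r : ℕ) :
    ℝ≥0∞ :=
  M * doublingConst d q C 7 * averageConst d q C ^ q⁻¹ * g *
      ((((2 * N + 1) ^ d : ℕ) : ℝ≥0∞)⁻¹ * if r ≤ 6 * N then 1 else 0) +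
    M * doublingConst d q C 7 * C ^ q⁻¹ * H (max (r - 3 * N) N)

theorem antitone_ite_le_one_zero (R : ℕ) :
    Antitone fun r : ℕ => if r ≤ R then (1 : ℝ≥0∞) else 0 := fun r s h => by
  dsimp only
  split_ifs <;> first | omega | simp

theorem couplingProfile_antitone (hH : Antitone H) (g : ℝ≥0∞) (N : ℕ) :
    Antitone (couplingProfile d q C M g H N) := fun r s h => by
  have h1 := antitone_ite_le_one_zero (6 * N) h
  have h2 : H (max (s - 3 * N) N) ≤ H (max (r - 3 * N) N) := hH (by omega)
  exact add_le_add (mul_le_mul_right (mul_le_mul_right h1 _) _) (mul_le_mul_right h2 _)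

/-- The factor in front of ε does not depend on N, so a large scale makes the coupling arbitrarily
small. The near part costs 6^d, since 2·6N+1 ≤ 6(2N+1). -/
theorem profileSum_couplingProfile_le (hH : Antitone H) {g ε : ℝ≥0∞} {N : ℕ} (hg : g ≤ ε)
    (hε : profileSum d (fun r => H (max r N)) ≤ ε) :
    profileSum d (couplingProfile d q C M g H N) ≤
      (M * doublingConst d q C 7 * averageConst d q C ^ q⁻¹ * (6 ^ d : ℕ) +
        M * doublingConst d q C 7 * C ^ q⁻¹ * (9 ^ d : ℕ)) * ε := by
  have e : couplingProfile d q C M g H N = fun r =>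
    M * doublingConst d q C 7 * averageConst d q C ^ q⁻¹ * g *
      ((((2 * N + 1) ^ d : ℕ) : ℝ≥0∞)⁻¹ * if r ≤ 6 * N then 1 else 0) +
    M * doublingConst d q C 7 * C ^ q⁻¹ * H (max (r - 3 * N) N) := rfl
  have h1 : (((2 * N + 1) ^ d : ℕ) : ℝ≥0∞)⁻¹ * (((2 * (6 * N) + 1) ^ d : ℕ) : ℝ≥0∞)
      ≤ (6 ^ d : ℕ) := by
    rw [mul_comm, ← div_eq_mul_inv]
    refine ENNReal.div_le_of_le_mul ?_
    rw [← Nat.cast_mul, ← mul_pow]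
    exact Nat.cast_le.2 (Nat.pow_le_pow_left (by omega) d)
  -- max(r-3N, N) ≥ max(r/4, N), by distinguishing r ≥ 4N from r < 4N; dilation by 4 costs (2·4+1)^d
  -- = 9^d.
  have h2 : profileSum d (fun r => H (max (r - 3 * N) N)) ≤ (9 ^ d : ℕ) * ε := by
    refine (profileSum_mono (G := fun r => (fun s => H (max s N)) (r / 4)) fun r => ?_).trans
      ((profileSum_comp_div_le (fun s => H (max s N)) four_ne_zero).trans ?_)
    · exact hH (by omega)
    · exact mul_le_mul_right hε _
  rw [e, profileSum_add, profileSum_const_mul, profileSum_const_mul, profileSum_const_mul,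
    profileSum_indicator, add_mul]
  refine add_le_add ?_ ?_
  · calc _ ≤ M * doublingConst d q C 7 * averageConst d q C ^ q⁻¹ * ε * (6 ^ d : ℕ) := by gcongr
      _ = _ := by ring
  · rw [mul_assoc _ _ ε]
    exact mul_le_mul_right h2 _

end Coupling

/-! ### Localized stability and the profile of the inverse. -/

section Localization

variable {𝕜 : Type*} [RCLike 𝕜] {d : ℕ} {A : Matrix (Fin d → ℤ) (Fin d → ℤ) 𝕜}
  {H G : ℕ → ℝ≥0∞} {q : ℝ} [Fact (1 ≤ q)] {w : PosSeq (Fin d → ℤ)} {C M : ℝ≥0∞}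
  {T U : WeightedLq 𝕜 q w →L[𝕜] WeightedLq 𝕜 q w}

/-- For j in B(n,5N) the cutoff difference is at most min(1, |i-j|/N). For other j the cutoff
vanishes at j, so only i in B(n,2N) contributes, and then |i-j| ≥ |j-n| - 2N. -/
theorem HasProfile.enorm_commutator_le (hA : HasProfile A H) (hH : Antitone H) {N : ℕ}
    (hN : N ≠ 0) (hG : ∀ r : ℕ, H r * min 1 ((r : ℝ≥0∞) / N) ≤ G r) (n i j : Fin d → ℤ)
    (z : ℝ≥0∞) :
    ‖A i j‖ₑ * (‖((cutoff N (latticeNorm (j - n)) - cutoff N (latticeNorm (i - n)) : ℝ) : 𝕜)‖ₑ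
      * z) ≤
    G (latticeNorm (i - j)) * (if j ∈ latticeBall n (5 * N) then z else 0) +
      (if i ∈ latticeBall n (2 * N) then 1 else 0) *
      (if j ∈ latticeBall n (5 * N) then 0 else H (latticeNorm (j - n) - 2 * N) * z) := by
  set x := cutoff N (latticeNorm (j - n)) - cutoff N (latticeNorm (i - n)) with hx
  have hxn : ‖(x : 𝕜)‖ₑ = ENNReal.ofReal |x| := by
    rw [← ofReal_norm, RCLike.norm_ofReal]
  have h1 : ‖(x : 𝕜)‖ₑ ≤ 1 := by
    rw [hxn]
    exact ENNReal.ofReal_le_one.2 (abs_cutoff_sub_le_one _ _ _)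
  have t1 := latticeNorm_sub_le j i n
  have t2 := latticeNorm_sub_le i j n
  rw [latticeNorm_sub_comm j i] at t1
  by_cases hj : j ∈ latticeBall n (5 * N)
  · have h2 : ‖(x : 𝕜)‖ₑ ≤ (latticeNorm (i - j) : ℝ≥0∞) / N := by
      rw [hxn]
      refine (ENNReal.ofReal_le_ofReal (abs_cutoff_sub_le (t := latticeNorm (i - j))
        (by omega) (by omega))).trans_eq ?_
      rw [ENNReal.ofReal_div_of_pos (Nat.cast_pos.2 (Nat.pos_of_ne_zero hN)),
        ENNReal.ofReal_natCast, ENNReal.ofReal_natCast]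
    rw [if_pos hj, if_pos hj, mul_zero, add_zero, ← mul_assoc]
    exact mul_le_mul_left ((mul_le_mul' (hA i j) (le_min h1 h2)).trans (hG _)) _
  · rw [if_neg hj, if_neg hj, mul_zero, zero_add]
    rw [mem_latticeBall] at hj
    have hj0 : cutoff N (latticeNorm (j - n)) = 0 := cutoff_eq_zero hN (by omega)
    by_cases hi : i ∈ latticeBall n (2 * N)
    · rw [if_pos hi, one_mul]
      rw [mem_latticeBall] at hi
      refine mul_le_mul' ((hA i j).trans (hH (by omega))) ?_
      exact (mul_le_mul_left h1 z).trans_eq (one_mul z)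
    · rw [mem_latticeBall] at hi
      have hi0 : cutoff N (latticeNorm (i - n)) = 0 := cutoff_eq_zero hN (by omega)
      rw [hx, hj0, hi0]
      simp

/-- Localization of the stability inequality of a matrix in the Beurling class. -/
theorem HasProfile.lqNorm_ballPart_le [NeZero d] (hA : HasProfile A H) (hH : Antitone H)
    (hC : BallMeanBound q w C) (hT : IsOperatorOf A T) (hM : ∀ c, ‖c‖ₑ ≤ M * ‖T c‖ₑ) {N : ℕ}
    (hN : N ≠ 0) (hG : Antitone G) (hGs : profileSum d G ≠ ∞)
    (hHG : ∀ r : ℕ, H r * min 1 ((r : ℝ≥0∞) / N) ≤ G r) (c : WeightedLq 𝕜 q w)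
    (n : Fin d → ℤ) :
    lqNorm q w (ballPart n N fun j => ‖c j‖ₑ) ≤
      M * (lqNorm q w (ballPart n (2 * N) fun j => ‖T c j‖ₑ) +
        (averageConst d q C ^ q⁻¹ * profileSum d G *
            lqNorm q w (ballPart n (5 * N) fun j => ‖c j‖ₑ) +
          ballWeight w n (2 * N) ^ q⁻¹ *
            ∑' j, (if j ∈ latticeBall n (5 * N) then 0
              else H (latticeNorm (j - n) - 2 * N) * ‖c j‖ₑ))) := by
  have hq : (1 : ℝ) ≤ q := Fact.out
  set ψ : (Fin d → ℤ) → ℝ := fun j => cutoff N (latticeNorm (j - n)) with hψ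
  have hψle : ∀ (c : WeightedLq 𝕜 q w) j, ‖(ψ j : 𝕜) * c j‖ₑ
      ≤ ballPart n (2 * N) (fun j => ‖c j‖ₑ) j := by
    intro c j
    rw [ballPart, enorm_mul]
    split_ifs with h
    · refine (mul_le_mul_left ?_ _).trans_eq (one_mul _)
      rw [← ofReal_norm, RCLike.norm_ofReal, abs_of_nonneg (cutoff_nonneg _ _)]
      exact ENNReal.ofReal_le_one.2 (cutoff_le_one _ _)
    · rw [mem_latticeBall] at h
      simp [hψ, cutoff_eq_zero hN (show 2 * N ≤ latticeNorm (j - n) by omega)]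
  have hpart : ∀ (R : ℕ) (c : (Fin d → ℤ) → ℝ≥0∞) j, ballPart n R c j ≤ c j := by
    intro R c j
    rw [ballPart]
    split_ifs
    exacts [le_rfl, zero_le]
  let c' : WeightedLq 𝕜 q w := WeightedLq.ofLqNorm (fun j => (ψ j : 𝕜) * c j)
    (ne_top_of_le_ne_top c.lqNorm_ne_top
      (lqNorm_mono hq fun j => (hψle c j).trans (hpart _ _ j)))
  set y := ∑' j, (if j ∈ latticeBall n (5 * N) then 0
    else H (latticeNorm (j - n) - 2 * N) * ‖c j‖ₑ) with hy
  -- The commutator of T with multiplication by ψ: near points give a convolution with G, far points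
  -- a constant y on B(n,2N). Stability is applied to c' = ψc.
  have hD : ∀ i, ‖T c' i - (ψ i : 𝕜) * T c i‖ₑ ≤
      profileConv G (ballPart n (5 * N) fun j => ‖c j‖ₑ) i
        + y * ballPart n (2 * N) (fun _ => 1) i := by
    intro i
    have h := (hT c' i).sub ((hT c i).mul_left (ψ i : 𝕜))
    rw [← h.tsum_eq]
    refine enorm_tsum_le_tsum_enorm.trans ?_
    rw [hy, mul_comm (tsum _), ← ENNReal.tsum_mul_left, profileConv, ← ENNReal.tsum_add]
    refine ENNReal.tsum_le_tsum fun j => ?_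
    refine le_trans (le_of_eq ?_) (hA.enorm_commutator_le hH hN hHG n i j ‖c j‖ₑ)
    rw [← enorm_mul, ← enorm_mul]
    congr 1
    change A i j * ((ψ j : 𝕜) * c j) - _ = _
    push_cast
    ring
  have h1 : lqNorm q w (ballPart n N fun j => ‖c j‖ₑ) ≤ ‖c'‖ₑ := by
    rw [WeightedLq.enorm_eq_lqNorm]
    refine lqNorm_mono hq fun j => ?_
    rw [ballPart]
    split_ifs with h
    · rw [mem_latticeBall] at h
      change _ ≤ ‖(ψ j : 𝕜) * c j‖ₑ
      simp [hψ, cutoff_eq_one h]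
    · exact zero_le
  refine h1.trans ((hM c').trans (mul_le_mul_right ?_ _))
  rw [WeightedLq.enorm_eq_lqNorm]
  calc lqNorm q w (fun i => ‖T c' i‖ₑ)
      ≤ lqNorm q w (fun i => ballPart n (2 * N) (fun j => ‖T c j‖ₑ) i +
          (profileConv G (ballPart n (5 * N) fun j => ‖c j‖ₑ) i
            + y * ballPart n (2 * N) (fun _ => 1) i)) := by
        refine lqNorm_mono hq fun i => ?_
        calc ‖T c' i‖ₑ = ‖(ψ i : 𝕜) * T c i + (T c' i - (ψ i : 𝕜) * T c i)‖ₑ := by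
              rw [add_sub_cancel]
          _ ≤ _ := (enorm_add_le _ _).trans (add_le_add (hψle (T c) i) (hD i))
    _ ≤ lqNorm q w (ballPart n (2 * N) fun j => ‖T c j‖ₑ) +
          (lqNorm q w (profileConv G (ballPart n (5 * N) fun j => ‖c j‖ₑ))
            + lqNorm q w fun i => y * ballPart n (2 * N) (fun _ => 1) i) :=
        (lqNorm_add_le hq _ _).trans (add_le_add_right (lqNorm_add_le hq _ _) _)
    _ ≤ _ := by
        rw [lqNorm_const_mul hq, lqNorm_ballPart_one hq, mul_comm y]
        gcongr
        exact hC.lqNorm_profileConv_le hq hG hGs _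

/-- Localized stability divided by w(B(n,N))^{1/q}. Every other ball weight is absorbed by doubling,
leaving an inequality whose coefficients are uniform in n and k. -/
theorem HasProfile.localMean_le [NeZero d] (hA : HasProfile A H) (hH : Antitone H)
    (hC : BallMeanBound q w C) (hT : IsOperatorOf A T) (hM : ∀ c, ‖c‖ₑ ≤ M * ‖T c‖ₑ) {N : ℕ}
    (hN : N ≠ 0) (hG : Antitone G) (hGs : profileSum d G ≠ ∞)
    (hHG : ∀ r : ℕ, H r * min 1 ((r : ℝ≥0∞) / N) ≤ G r) (c : WeightedLq 𝕜 q w)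
    (k : Fin d → ℤ) (hc : T c = WeightedLq.single k) (n : Fin d → ℤ) :
    localMean q w N (fun j => ‖c j‖ₑ) n ≤
      M * doublingConst d q C 7 * (if latticeNorm (n - k) ≤ 2 * N then 1 else 0) +
        profileConv (couplingProfile d q C M (profileSum d G) H N)
          (localMean q w N fun j => ‖c j‖ₑ) n := by
  have hq : (1 : ℝ) ≤ q := Fact.out
  have hq' : 0 ≤ q⁻¹ := inv_nonneg.2 (by linarith)
  set x := localMean q w N (fun j => ‖c j‖ₑ) with hx
  set p := ballWeight w n N ^ q⁻¹ with hp
  set D := doublingConst d q C 7 with hD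
  set K := averageConst d q C ^ q⁻¹ with hK
  -- The unit sequence at k has norm w(k)^{1/q}, at most D w(B(n,N))^{1/q} when k lies in B(n,2N);
  -- otherwise its restriction vanishes.
  have hsrc : lqNorm q w (ballPart n (2 * N) fun j => ‖T c j‖ₑ) ≤
      D * p * (if latticeNorm (n - k) ≤ 2 * N then 1 else 0) := by
    rw [hc]
    by_cases hk : latticeNorm (n - k) ≤ 2 * N
    · have hk' : k ∈ latticeBall n (2 * N) := by
        rwa [mem_latticeBall, latticeNorm_sub_comm]
      rw [if_pos hk, mul_one]
      refine le_trans (lqNorm_mono hq fun j => ?_) ((lqNorm_single (𝕜 := 𝕜) hq k).le.trans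
        ((ENNReal.rpow_le_rpow (weight_le_ballWeight hk') hq').trans
        (hC.ballWeight_rpow_le_seven hq ?_)))
      · rw [ballPart]
        split_ifs
        exacts [le_rfl, zero_le]
      · rw [sub_self, latticeNorm_zero]
        omega
    · rw [if_neg hk, mul_zero, ← lqNorm_zero (w := w) hq]
      refine lqNorm_mono hq fun j => ?_
      rw [ballPart]
      split_ifs with hj
      · rw [WeightedLq.single_apply, if_neg, enorm_zero]
        rintro rfl
        rw [mem_latticeBall, latticeNorm_sub_comm] at hj
        exact hk hj
      · exact le_rfl
  have hfar := hC.tsum_far_le hq hH (fun j => ‖c j‖ₑ) n N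
  have hnear := hC.lqNorm_near_le hq (fun j => ‖c j‖ₑ) n N
  have hw2 : ballWeight w n (2 * N) ^ q⁻¹ ≤ D * p := by
    refine hC.ballWeight_rpow_le_seven hq ?_
    rw [sub_self, latticeNorm_zero]
    omega
  have main := hA.lqNorm_ballPart_le hH hC hT hM hN hG hGs hHG c n
  have hconv : profileConv (couplingProfile d q C M (profileSum d G) H N) x n =
      M * D * K * profileSum d G * profileConv (fun r =>
        (((2 * N + 1) ^ d : ℕ) : ℝ≥0∞)⁻¹ * if r ≤ 6 * N then 1 else 0) x n +
      M * D * C ^ q⁻¹ * profileConv (fun r => H (max (r - 3 * N) N)) x n := by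
    simp only [profileConv, couplingProfile, add_mul, ENNReal.tsum_add, mul_assoc,
      ENNReal.tsum_mul_left]
    rfl
  rw [← localMean_mul hq, ← hx, ← hp] at main
  rw [← ENNReal.mul_le_mul_iff_left (ballWeight_rpow_ne_zero (w := w) hq n N)
    (ballWeight_rpow_ne_top hq n N), ← hp, hconv]
  refine main.trans ?_
  calc _ ≤ M * (D * p * (if latticeNorm (n - k) ≤ 2 * N then 1 else 0) +
        (K * profileSum d G * (D * p * profileConv (fun r =>
          (((2 * N + 1) ^ d : ℕ) : ℝ≥0∞)⁻¹ * if r ≤ 6 * N then 1 else 0) x n) +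
        D * p * (C ^ q⁻¹ * profileConv (fun r => H (max (r - 3 * N) N)) x n))) := by
        gcongr
    _ = _ := by ring

/-- At a large scale `N`, the tail and the commutator profiles have small sums. -/
theorem exists_scale [NeZero d] (hH : Antitone H) (hHs : profileSum d H ≠ ∞) {ε : ℝ≥0∞}
    (hε : ε ≠ 0) : ∃ N : ℕ, N ≠ 0 ∧ profileSum d (fun r => H (max r N)) ≤ ε ∧
      ∃ G : ℕ → ℝ≥0∞, Antitone G ∧ profileSum d G ≤ ε ∧
        ∀ r : ℕ, H r * min 1 ((r : ℝ≥0∞) / N) ≤ G r := by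
  have hε2 : ε / 2 ≠ 0 := by simp [hε]
  -- L makes the tail small; then N makes L/N times the sum of H small. The scale N+L+1 is nonzero
  -- and at least L. In G, the first term serves r ≤ L, where r/(N+L+1) ≤ L/(N+L+1), and the second
  -- serves r ≥ L.
  obtain ⟨L, hL⟩ := ((tendsto_profileSum_max hH hHs).eventually
    (ge_mem_nhds (pos_iff_ne_zero.2 hε2))).exists
  obtain ⟨N, hN⟩ := ENNReal.exists_nat_mul_gt hε2
    (ENNReal.mul_ne_top (ENNReal.natCast_ne_top L) hHs)
  have hmax : ∀ n, Antitone fun r => H (max r n) := fun n r s h => hH (max_le_max_right n h)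
  have hP0 : (((N + L + 1 : ℕ)) : ℝ≥0∞) ≠ 0 := by
    rw [Ne, Nat.cast_eq_zero]
    omega
  have hPt : (((N + L + 1 : ℕ)) : ℝ≥0∞) ≠ ∞ := ENNReal.natCast_ne_top _
  refine ⟨N + L + 1, by omega, ?_,
    fun r => (L : ℝ≥0∞) / (N + L + 1 : ℕ) * H r + H (max r L), fun r s h => ?_, ?_, fun r => ?_⟩
  · refine (profileSum_mono fun r => hH (b := max r (N + L + 1)) (a := max r L) (by omega)).trans
      (hL.trans ENNReal.half_le_self)
  · exact add_le_add (mul_le_mul_right (hH h) _) (hmax L h)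
  · rw [profileSum_add, profileSum_const_mul, ← ENNReal.add_halves ε]
    refine add_le_add ?_ hL
    rw [div_eq_mul_inv, mul_right_comm, ← div_eq_mul_inv]
    refine ENNReal.div_le_of_le_mul ?_
    refine hN.le.trans ?_
    rw [mul_comm]
    exact mul_le_mul_right (Nat.cast_le.2 (by omega)) _
  · rcases le_total r L with h | h
    · refine le_add_right ?_
      rw [mul_comm]
      refine mul_le_mul_left ((min_le_right _ _).trans ?_) _
      exact ENNReal.div_le_div_right (Nat.cast_le.2 h) _
    · refine le_add_left ?_
      rw [max_eq_left h]
      exact (mul_le_mul_right (min_le_left _ _) _).trans_eq (mul_one _)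

/-- The columns of the inverse of a stable matrix in the Beurling class have a common profile. -/
theorem HasProfile.exists_profile_of_stable [NeZero d] (hA : HasProfile A H) (hH : Antitone H)
    (hHs : profileSum d H ≠ ∞) (hC : BallMeanBound q w C) (hCt : C ≠ ∞)
    (hT : IsOperatorOf A T) (hMt : M ≠ ∞) (hM : ∀ c, ‖c‖ₑ ≤ M * ‖T c‖ₑ) :
    ∃ P : ℕ → ℝ≥0∞, Antitone P ∧ profileSum d P ≠ ∞ ∧ ∀ (c : WeightedLq 𝕜 q w) (k : Fin d → ℤ),
      T c = WeightedLq.single k → ∀ i, ‖c i‖ₑ ≤ P (latticeNorm (i - k)) := by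
  have hq : (1 : ℝ) ≤ q := Fact.out
  have hq' : 0 ≤ q⁻¹ := inv_nonneg.2 (by linarith)
  set D := doublingConst d q C 7 with hD
  set K := averageConst d q C ^ q⁻¹ with hK
  have hDt : D ≠ ∞ := doublingConst_ne_top hq hCt 7
  have hKt : K ≠ ∞ := ENNReal.rpow_ne_top_of_nonneg hq' (averageConst_ne_top hq hCt)
  have hMD : M * D ≠ ∞ := ENNReal.mul_ne_top hMt hDt
  set Z : ℝ≥0∞ := M * D * K * (6 ^ d : ℕ) + M * D * C ^ q⁻¹ * (9 ^ d : ℕ) with hZ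
  have hZt : Z ≠ ∞ := ENNReal.add_ne_top.2
    ⟨ENNReal.mul_ne_top (ENNReal.mul_ne_top hMD hKt) (ENNReal.natCast_ne_top _),
      ENNReal.mul_ne_top (ENNReal.mul_ne_top hMD (ENNReal.rpow_ne_top_of_nonneg hq' hCt))
        (ENNReal.natCast_ne_top _)⟩
  -- One ε = 1/(2Y) meets two demands with factor 1/2: 2·5^d makes the Neumann series of profiles
  -- summable, K makes convolution with V a contraction of ℓ^q_w. The summand 1 keeps Y nonzero.
  set Y : ℝ≥0∞ := (2 * (5 ^ d : ℕ) + K) * Z + 1 with hY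
  have hYt : Y ≠ ∞ := ENNReal.add_ne_top.2 ⟨ENNReal.mul_ne_top (ENNReal.add_ne_top.2
    ⟨ENNReal.mul_ne_top ENNReal.ofNat_ne_top (ENNReal.natCast_ne_top _), hKt⟩) hZt,
    ENNReal.one_ne_top⟩
  have hY0 : Y ≠ 0 := by simp [hY]
  have hε : 2⁻¹ / Y ≠ 0 := by simp [hYt]
  obtain ⟨N, hN, htail, G, hG, hGε, hHG⟩ := exists_scale (d := d) hH hHs hε
  have hεt : 2⁻¹ / Y ≠ ∞ := ENNReal.div_ne_top (by simp) hY0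
  set V := couplingProfile d q C M (profileSum d G) H N with hV
  have hVa : Antitone V := couplingProfile_antitone hH _ N
  have hVs : profileSum d V ≤ Z * (2⁻¹ / Y) := profileSum_couplingProfile_le hH hGε htail
  have hsmall : ∀ t, t ≤ 2 * (5 ^ d : ℕ) + K → t * profileSum d V ≤ 2⁻¹ := by
    intro t ht
    calc t * profileSum d V ≤ (2 * (5 ^ d : ℕ) + K) * (Z * (2⁻¹ / Y)) := mul_le_mul' ht hVs
      _ = ((2 * (5 ^ d : ℕ) + K) * Z) * (2⁻¹ / Y) := (mul_assoc _ _ _).symm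
      _ ≤ Y * (2⁻¹ / Y) := mul_le_mul_left le_self_add _
      _ = 2⁻¹ := ENNReal.mul_div_cancel hY0 hYt
  have hV1 := hsmall _ le_self_add
  have hV2 := hsmall _ le_add_self
  have hVt : profileSum d V ≠ ∞ := ne_top_of_le_ne_top (ENNReal.mul_ne_top hZt hεt) hVs
  set b : ℕ → ℝ≥0∞ := fun r => M * D * if r ≤ 2 * N then 1 else 0 with hb
  have hba : Antitone b := fun r s h =>
    mul_le_mul_right (antitone_ite_le_one_zero (2 * N) h) _
  have hbs : profileSum d b ≠ ∞ := by
    rw [hb, profileSum_const_mul, profileSum_indicator]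
    exact ENNReal.mul_ne_top hMD (ENNReal.natCast_ne_top _)
  refine ⟨fun r => doublingConst d q C (2 * N + 1) * profileNeumann d V b r,
    fun r s h => mul_le_mul_right (profileNeumann_antitone hVa hba h) _, ?_, fun c k hc i => ?_⟩
  · rw [profileSum_const_mul]
    exact ENNReal.mul_ne_top (doublingConst_ne_top hq hCt _) (ne_top_of_le_ne_top
      (ENNReal.mul_ne_top ENNReal.ofNat_ne_top hbs) (profileSum_profileNeumann_le hV1))
  · refine (hC.le_localMean hq (fun j => ‖c j‖ₑ) i N).trans (mul_le_mul_right ?_ _)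
    refine le_profileNeumann hVa hba
      (fun n => hA.localMean_le hH hC hT hM hN hG (ne_top_of_le_ne_top hεt hGε) hHG c k hc n) i ?_
    have hxt := lqNorm_localMean_ne_top hq c.lqNorm_ne_top N
    set x := localMean q w N fun j => ‖c j‖ₑ
    -- Contraction, together with the finite norm of x, sends the remainder to 0 in ℓ^q_w and hence
    -- pointwise.
    have hiter : ∀ n, lqNorm q w ((profileConv V)^[n] x) ≤ 2⁻¹ ^ n * lqNorm q w x := by
      intro n
      induction n with
      | zero => simp
      | succ n ih =>
        rw [Function.iterate_succ_apply', pow_succ', mul_assoc]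
        exact (hC.lqNorm_profileConv_le hq hVa hVt _).trans (mul_le_mul' hV2 ih)
    refine tendsto_zero_of_lqNorm hq (w := w) (c := fun n => (profileConv V)^[n] x) ?_ i
    have h0 : Filter.Tendsto (fun n : ℕ => (2⁻¹ : ℝ≥0∞) ^ n * lqNorm q w x) Filter.atTop
        (nhds (0 * lqNorm q w x)) :=
      ENNReal.Tendsto.mul_const (ENNReal.tendsto_pow_atTop_nhds_zero_of_lt_one
        (by simp)) (Or.inr hxt)
    rw [zero_mul] at h0
    exact tendsto_of_tendsto_of_tendsto_of_le_of_le tendsto_const_nhds h0 (fun _ => zero_le) hiter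

/-- The candidate B has the columns U e_k, with e_k the unit sequences; they have a common profile
because T is stable with constant ‖U‖. -/
theorem IsOperatorOf.exists_of_inverse [NeZero d] (hC : BallMeanBound q w C) (hCt : C ≠ ∞)
    (hA : A ∈ beurlingClass 𝕜 d) (hT : IsOperatorOf A T) (hTU : T * U = 1) (hUT : U * T = 1) :
    ∃ B ∈ beurlingClass 𝕜 d, IsOperatorOf B U := by
  obtain ⟨F, hF, hFs, hAF⟩ := mem_beurlingClass_iff.1 hA
  have hM : ∀ c, ‖c‖ₑ ≤ ‖U‖ₑ * ‖T c‖ₑ := fun c => by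
    have h : c = U (T c) := (DFunLike.congr_fun hUT c).symm
    conv_lhs => rw [h]
    exact U.le_opENorm _
  obtain ⟨P, hP, hPs, hcol⟩ := hAF.exists_profile_of_stable hF hFs hC hCt hT enorm_ne_top hM
  have hTUs : ∀ k, T (U (WeightedLq.single k)) = WeightedLq.single k := fun k =>
    DFunLike.congr_fun hTU _
  let B : Matrix (Fin d → ℤ) (Fin d → ℤ) 𝕜 := Matrix.of fun i k => U (WeightedLq.single k) i
  have hBP : HasProfile B P := fun i k => hcol _ k (hTUs k) i
  obtain ⟨U', hU'⟩ := hBP.exists_isOperatorOf hP hPs hC hCt (q := q) (w := w)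
  have hAB : infMatrixMul A B = Matrix.diagonal fun _ => (1 : 𝕜) := by
    ext i k
    change ∑' j, A i j * U (WeightedLq.single k) j = _
    rw [(hT (U (WeightedLq.single k)) i).tsum_eq, hTUs, WeightedLq.single_apply,
      Matrix.diagonal_apply]
  -- That B defines U, not merely agrees with it on unit sequences, is algebraic: AB = I gives TU' =
  -- 1, so U' = UTU' = U. No density argument is needed.
  have h1 := hAF.isOperatorOf_mul hF hFs hBP hP hPs hC hCt hT hU'
  rw [hAB] at h1
  have h2 : T * U' = 1 := (h1.unique (isOperatorOf_diagonal 1)).trans (map_one _)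
  have h3 : U' = U := by rw [← one_mul U', ← hUT, mul_assoc, h2, mul_one]
  exact ⟨B, mem_beurlingClass_iff.2 ⟨P, hP, hPs, hBP⟩, h3 ▸ hU'⟩

end Localization

/-! ### Assembly of the theorem. -/

theorem mainTheorem1 {𝕜 : Type*} [RCLike 𝕜] {d : ℕ} (hd : 1 ≤ d) (q : ℝ) [Fact (1 ≤ q)]
    (w : PosSeq (Fin d → ℤ)) (hw : IsDiscreteAqWeight q w) :
    -- every matrix in the class defines a bounded operator
    (∀ A ∈ beurlingClass 𝕜 d,
      ∃! T : WeightedLq 𝕜 q w →L[𝕜] WeightedLq 𝕜 q w, IsOperatorOf A T) ∧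
    -- different matrices define different operators
    (∀ A ∈ beurlingClass 𝕜 d, ∀ B ∈ beurlingClass 𝕜 d,
      ∀ T : WeightedLq 𝕜 q w →L[𝕜] WeightedLq 𝕜 q w,
        IsOperatorOf A T → IsOperatorOf B T → A = B) ∧
    -- the class is closed under the matrix product, which corresponds to composition
    (∀ A ∈ beurlingClass 𝕜 d, ∀ B ∈ beurlingClass 𝕜 d,
      (∀ i k, Summable fun j => A i j * B j k) ∧ infMatrixMul A B ∈ beurlingClass 𝕜 d ∧
      ∀ T U : WeightedLq 𝕜 q w →L[𝕜] WeightedLq 𝕜 q w,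
        IsOperatorOf A T → IsOperatorOf B U → IsOperatorOf (infMatrixMul A B) (T * U)) ∧
    -- the operators given by the class form an inverse-closed subalgebra
    ∃ S : Subalgebra 𝕜 (WeightedLq 𝕜 q w →L[𝕜] WeightedLq 𝕜 q w),
      (∀ T, T ∈ S ↔ ∃ A ∈ beurlingClass 𝕜 d, IsOperatorOf A T) ∧ S.IsInverseClosed := by
  have : NeZero d := ⟨by omega⟩
  obtain ⟨C, hCt, hC⟩ := hw.exists_ballMeanBound
  have hex : ∀ A ∈ beurlingClass 𝕜 d,
      ∃ T : WeightedLq 𝕜 q w →L[𝕜] WeightedLq 𝕜 q w, IsOperatorOf A T := fun A hA => by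
    obtain ⟨F, hF, hFs, hAF⟩ := mem_beurlingClass_iff.1 hA
    exact hAF.exists_isOperatorOf hF hFs hC hCt
  have hmul : ∀ A ∈ beurlingClass 𝕜 d, ∀ B ∈ beurlingClass 𝕜 d,
      ∀ T U : WeightedLq 𝕜 q w →L[𝕜] WeightedLq 𝕜 q w,
        IsOperatorOf A T → IsOperatorOf B U → IsOperatorOf (infMatrixMul A B) (T * U) := by
    intro A hA B hB T U hT hU
    obtain ⟨F, hF, hFs, hAF⟩ := mem_beurlingClass_iff.1 hA
    obtain ⟨G, hG, hGs, hBG⟩ := mem_beurlingClass_iff.1 hB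
    exact hAF.isOperatorOf_mul hF hFs hBG hG hGs hC hCt hT hU
  refine ⟨fun A hA => ?_, fun A _ B _ T hA hB => hA.matrix_unique hB, fun A hA B hB =>
    ⟨summable_mul_of_mem_beurlingClass hA hB, infMatrixMul_mem_beurlingClass hA hB,
      hmul A hA B hB⟩, ?_⟩
  · obtain ⟨T, hT⟩ := hex A hA
    exact ⟨T, hT, fun U hU => IsOperatorOf.unique hU hT⟩
  · refine ⟨{ carrier := {T | ∃ A ∈ beurlingClass 𝕜 d, IsOperatorOf A T}
              mul_mem' := ?_
              add_mem' := ?_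
              algebraMap_mem' := ?_ }, fun T => Iff.rfl, ?_⟩
    · rintro T U ⟨A, hA, hT⟩ ⟨B, hB, hU⟩
      exact ⟨_, infMatrixMul_mem_beurlingClass hA hB, hmul A hA B hB T U hT hU⟩
    · rintro T U ⟨A, hA, hT⟩ ⟨B, hB, hU⟩
      exact ⟨_, add_mem_beurlingClass hA hB, hT.add hU⟩
    · exact fun r => ⟨_, diagonal_mem_beurlingClass r, isOperatorOf_diagonal r⟩
    · rintro T ⟨A, hA, hT⟩ U hTU hUT
      exact hT.exists_of_inverse hC hCt hA hTU hUT
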